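/- Let $\mathbb F$ be a field of characteristic zero and $G$ a torsion-free abelian group. Let $P$ be a unital associative $\mathbb F$-algebra with an involution $*$ (an $\mathbb F$-linear anti-automorphism with $*\circ *=\mathrm{id}$), and let $J:=H(P,*)=\{x\in P\mid x^*=x\}$, a Jordan algebra with product $x\circ y=\frac12(xy+yx)$. Assume that $P$ is $*$-prime ($P\neq 0$ and the product of two nonzero $*$-stable ideals is nonzero) and is generated by $J$ as an associative algebra. Assume that $J=\bigoplus_{g\in G}J^g$ is a Jordan $G$-torus, i.e. this is a grading of the Jordan algebra $J$, the set $\{g\mid J^g\neq 0\}$ generates $G$, every nonzero homogeneous element is invertible in $J$, and $\dim_{\mathbb F}J^g\le 1$ for all $g\in G$. Let $\{G_i\mid i\in\mathcal I\}$ be a family of free abelian subgroups of $G$ with $G=\bigcup_{i\in\mathcal I}G_i$, let $J_i:=\bigoplus_{g\in G_i}J^g$, and let $P_i$ be the associative subalgebra of $P$ generated by $J_i$. Assume that for every $i$ the map $*$ restricts to an involution of $P_i$ and $J_i=H(P_i,*)$. For a field $K$ and a $2$-cocycle $\lambda:G\times G\to K^\times$, i.e. $\lambda(a+b,c)\lambda(a,b)=\lambda(a,b+c)\lambda(b,c)$,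 let $(K^t[G],\lambda)=\bigoplus_{g\in G}Kx^g$ be the $G$-graded twisted group algebra with $x^ax^b=\lambda(a,b)x^{a+b}$. Then $J$ is $G$-graded isomorphic, as a Jordan algebra, to at least one of the following: (1) (involution type) $H((\mathbb F^t[G],\lambda),\theta_q)$ for a $2$-cocycle $\lambda:G\times G\to\mathbb F^\times$ and a quadratic map $q:G\to\mathbb F_2$ with $(-1)^{q(a)+q(b)-q(a+b)}=\lambda(a,b)\lambda(b,a)^{-1}$, where $\theta_q$ is the involution $x^g\mapsto(-1)^{q(g)}x^g$; (2) (plus type) $(\mathbb F^t[G],\lambda)^+$, the space $(\mathbb F^t[G],\lambda)$ with product $\frac12(xy+yx)$, for a $2$-cocycle $\lambda:G\times G\to\mathbb F^\times$; (3) (extension type) $H((\mathbb E^t[G],\lambda),\sigma)$ for a quadratic field extension $\mathbb E/\mathbb F$, a $2$-cocycle $\lambda:G\times G\to\mathbb E^\times$ and a graded involution $\sigma$ of the $\mathbb F$-algebra $(\mathbb E^t[G],\lambda)$ which is semilinear with respect to the nontrivial automorphism of $\mathbb E$ over $\mathbb F$. Moreover, if $J$ is of involution (resp. plus, resp. extension)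 type, then $J$ is a direct union of Jordan tori of involution (resp. plus, resp. extension) type: there is a nonempty directed family of subgroups $H\le G$, each free abelian of finite rank, such that each $J_H:=\bigoplus_{g\in H}J^g$ is a Jordan $H$-torus of involution (resp. plus, resp. extension) type (defined as above with $H$ in place of $G$), and $J=\bigcup_H J_H$. -/

import Mathlib

universe u v w

/-! ### Involutions, symmetric elements, `*`-primeness -/

/-- An involution of an associative `F`-algebra: an `F`-linear anti-automorphism `σ` with
`σ ∘ σ = id`. -/
structure AlgInvolution (F : Type*) (A : Type*) [CommRing F] [Ring A] [Algebra F A]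
    extends A →ₗ[F] A where
  map_mul_rev' : ∀ a b : A, toFun (a * b) = toFun b * toFun a
  involutive' : ∀ a : A, toFun (toFun a) = a

namespace AlgInvolution

variable {F A : Type*} [CommRing F] [Ring A] [Algebra F A]

instance : CoeFun (AlgInvolution F A) (fun _ => A → A) where
  coe σ := σ.toLinearMap

/-- The space `H(A, σ)` of `σ`-symmetric elements. It is closed under the product
`a ∘ b = (ab + ba) / 2`, and is always regarded as a Jordan algebra with this product. -/
def H (σ : AlgInvolution F A) : Submodule F A where
  carrier := {a | σ a = a}
  add_mem' {a b} ha hb := by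
    change σ.toLinearMap (a + b) = a + b
    rw [map_add, show σ.toLinearMap a = a from ha, show σ.toLinearMap b = b from hb]
  zero_mem' := map_zero σ.toLinearMap
  smul_mem' c a ha := by
    change σ.toLinearMap (c • a) = c • a
    rw [map_smul, show σ.toLinearMap a = a from ha]

/-- `A` is `σ`-prime: `A ≠ 0`, and the product of two nonzero `σ`-stable (two-sided) ideals
is never zero. -/
def IsPrime (σ : AlgInvolution F A) : Prop :=
  Nontrivial A ∧ ∀ I K : TwoSidedIdeal A,
    (∀ x ∈ I, σ x ∈ I) → (∀ x ∈ K, σ x ∈ K) → (∀ x ∈ I, ∀ y ∈ K, x * y = 0) → I = ⊥ ∨ K = ⊥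

end AlgInvolution

/-! ### Jordan tori

The Jordan algebras here are subspaces `V` of a unital associative algebra `A` over a field of
characteristic zero which contain `1` and are closed under `a ∘ b = (ab + ba) / 2`. -/

section Jordan

variable (F : Type*) {A : Type*} [Field F] [Ring A] [Algebra F A]

/-- The Jordan product `a ∘ b = (ab + ba) / 2` of the plus algebra `A⁺`. -/
def jordanMul (a b : A) : A := (2⁻¹ : F) • (a * b + b * a)

/-- The Jordan product is the product of Mathlib's symmetrized algebra. -/
theorem jordanMul_eq_unsym [CharZero F] [Invertible (2 : A)] (a b : A) :
    jordanMul F a b = SymAlg.unsym (SymAlg.sym a * SymAlg.sym b) := by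
  have h2 : algebraMap F A 2⁻¹ = ⅟(2 : A) := by
    refine (invOf_eq_left_inv ?_).symm
    have h : (2 : A) = algebraMap F A 2 := (map_ofNat (algebraMap F A) 2).symm
    rw [h, ← map_mul, inv_mul_cancel₀ two_ne_zero, map_one]
  rw [SymAlg.sym_mul_sym, SymAlg.unsym_sym, jordanMul, Algebra.smul_def, h2]

/-- `x` is invertible in the Jordan algebra `V`: for some `y ∈ V`, `x ∘ y = 1` and
`x² ∘ y = x`, where `x² = x ∘ x`. -/
def JordanInvertible (V : Submodule F A) (x : A) : Prop :=
  ∃ y ∈ V, jordanMul F x y = 1 ∧ jordanMul F (jordanMul F x x) y = x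

variable {F}
variable {G : Type*} [AddCommGroup G]

/-- The Jordan algebra `V`, graded by the subspaces `𝒥 g` (`g : G`), is a Jordan `G`-torus. -/
structure IsJordanTorus (V : Submodule F A) (𝒥 : G → Submodule F A) : Prop where
  /-- `V` is the direct sum of the subspaces `𝒥 g` ... -/
  indep : iSupIndep 𝒥
  iSup_eq : ⨆ g, 𝒥 g = V
  /-- ... it is a unital Jordan subalgebra of `A⁺`, graded by the `𝒥 g`; -/
  one_mem : (1 : A) ∈ V
  mul_mem : ∀ g h : G, ∀ x ∈ 𝒥 g, ∀ y ∈ 𝒥 h, jordanMul F x y ∈ 𝒥 (g + h)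
  /-- the support generates `G`; -/
  closure_supp : AddSubgroup.closure {g : G | 𝒥 g ≠ ⊥} = ⊤
  /-- nonzero homogeneous elements are invertible; -/
  invertible : ∀ g : G, ∀ x ∈ 𝒥 g, x ≠ 0 → JordanInvertible F V x
  /-- homogeneous spaces are at most one-dimensional. -/
  rank_le_one : ∀ g : G, Module.rank F (𝒥 g) ≤ 1

/-- The part `⨁_{g ∈ H} J^g` of a graded space supported on the subgroup `H`. -/
def gradedPart (𝒥 : G → Submodule F A) (H : AddSubgroup G) : Submodule F A :=
  ⨆ h : H, 𝒥 h

/-- The `H`-grading of `⨁_{g ∈ H} J^g`. -/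
def restrictGrading (𝒥 : G → Submodule F A) (H : AddSubgroup G) : H → Submodule F A :=
  fun h => 𝒥 h

/-- `G`-graded isomorphism of the Jordan algebras `V` and `W`, graded by `𝒥` and `𝒦`. -/
def GradedJordanIso {B : Type*} [Ring B] [Algebra F B]
    (V : Submodule F A) (𝒥 : G → Submodule F A)
    (W : Submodule F B) (𝒦 : G → Submodule F B) : Prop :=
  ∃ e : V ≃ₗ[F] W,
    (∀ x y z : V, (z : A) = jordanMul F (x : A) (y : A) →
      (e z : B) = jordanMul F (e x : B) (e y : B)) ∧
    ∀ (g : G) (x : V), (x : A) ∈ 𝒥 g ↔ (e x : B) ∈ 𝒦 g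

end Jordan

/-! ### Twisted group algebras -/

/-- A `2`-cocycle `lam : G × G → Kˣ` (trivial action). -/
structure TwoCocycle (G : Type*) (K : Type*) [AddCommGroup G] [CommRing K] where
  toFun : G → G → Kˣ
  cocycle : ∀ a b c : G, toFun (a + b) c * toFun a b = toFun a (b + c) * toFun b c

namespace TwoCocycle

variable {G K : Type*} [AddCommGroup G] [CommRing K]

instance : CoeFun (TwoCocycle G K) (fun _ => G → G → Kˣ) where
  coe lam := lam.toFun

theorem zero_left (lam : TwoCocycle G K) (a : G) : lam 0 a = lam 0 0 := by
  have h := lam.cocycle 0 0 a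
  rw [add_zero, zero_add] at h
  exact (mul_left_cancel h).symm

theorem zero_right (lam : TwoCocycle G K) (a : G) : lam a 0 = lam 0 0 := by
  have h := lam.cocycle a 0 0
  rw [add_zero, add_zero] at h
  exact mul_left_cancel h

end TwoCocycle

/-- The twisted group algebra `(K^t[G], lam)`: the free `K`-module on `x^g` (`g : G`) with
`x^a x^b = lam(a, b) x^(a + b)`. -/
def TwistedGroupAlgebra {G K : Type*} [AddCommGroup G] [CommRing K] (_lam : TwoCocycle G K) :
    Type _ := G →₀ K

namespace TwistedGroupAlgebra

variable {G K : Type*} [AddCommGroup G] [CommRing K] (lam : TwoCocycle G K)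

noncomputable instance : AddCommGroup (TwistedGroupAlgebra lam) :=
  inferInstanceAs (AddCommGroup (G →₀ K))

noncomputable instance {R : Type*} [Semiring R] [Module R K] :
    Module R (TwistedGroupAlgebra lam) :=
  inferInstanceAs (Module R (G →₀ K))

instance {R S : Type*} [Semiring R] [Semiring S] [Module R K] [Module S K] [SMul R S]
    [IsScalarTower R S K] : IsScalarTower R S (TwistedGroupAlgebra lam) :=
  inferInstanceAs (IsScalarTower R S (G →₀ K))

/-- The homogeneous element `c x^g`. -/
noncomputable def single (g : G) (c : K) : TwistedGroupAlgebra lam :=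
  (Finsupp.single g c : G →₀ K)

/-- `c ↦ c x^g` as a linear map. -/
noncomputable def lsingle (R : Type*) [Semiring R] [Module R K] (g : G) :
    K →ₗ[R] TwistedGroupAlgebra lam :=
  (Finsupp.lsingle g : K →ₗ[R] (G →₀ K))

@[simp] theorem lsingle_apply (R : Type*) [Semiring R] [Module R K] (g : G) (c : K) :
    lsingle lam R g c = single lam g c := rfl

/-- The linear map out of `K^t[G]` determined by its values on the `x^g`. -/
noncomputable def lift {M : Type*} [AddCommGroup M] [Module K M] (f : G → M) :
    TwistedGroupAlgebra lam →ₗ[K] M :=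
  (Finsupp.linearCombination K f : (G →₀ K) →ₗ[K] M)

@[simp] theorem lift_single {M : Type*} [AddCommGroup M] [Module K M] (f : G → M) (g : G)
    (c : K) : lift lam f (single lam g c) = c • f g :=
  Finsupp.linearCombination_single K c g

theorem smul_single {R : Type*} [Semiring R] [Module R K] (r : R) (g : G) (c : K) :
    r • single lam g c = single lam g (r • c) :=
  Finsupp.smul_single r g c

@[elab_as_elim]
theorem induction {lam : TwoCocycle G K} {p : TwistedGroupAlgebra lam → Prop}
    (f : TwistedGroupAlgebra lam) (zero : p 0) (add : ∀ f g, p f → p g → p (f + g))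
    (single : ∀ g c, p (single lam g c)) : p f :=
  Finsupp.induction_linear (motive := p) f zero add single

/-- The product, as a bilinear map. -/
noncomputable def mulHom : TwistedGroupAlgebra lam →ₗ[K] TwistedGroupAlgebra lam →ₗ[K]
    TwistedGroupAlgebra lam :=
  lift lam fun a => lift lam fun b => single lam (a + b) (lam a b : K)

noncomputable instance : Mul (TwistedGroupAlgebra lam) := ⟨fun f g => mulHom lam f g⟩

noncomputable instance : One (TwistedGroupAlgebra lam) :=
  ⟨single lam 0 (((lam 0 0)⁻¹ : Kˣ) : K)⟩

theorem mul_eq (f g : TwistedGroupAlgebra lam) : f * g = mulHom lam f g := rfl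

theorem one_eq : (1 : TwistedGroupAlgebra lam) = single lam 0 (((lam 0 0)⁻¹ : Kˣ) : K) := rfl

theorem single_mul_single (a b : G) (c d : K) :
    single lam a c * single lam b d = single lam (a + b) (c * d * (lam a b : K)) := by
  rw [mul_eq, mulHom, lift_single, LinearMap.smul_apply, lift_single, smul_single, smul_single]
  congr 1
  simp only [smul_eq_mul]
  ring

noncomputable instance : NonUnitalNonAssocRing (TwistedGroupAlgebra lam) where
  left_distrib f g h := by simp only [mul_eq, map_add]
  right_distrib f g h := by simp only [mul_eq, map_add, LinearMap.add_apply]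
  zero_mul f := by simp only [mul_eq, map_zero, LinearMap.zero_apply]
  mul_zero f := by simp only [mul_eq, map_zero]

noncomputable instance : Ring (TwistedGroupAlgebra lam) :=
  { (inferInstance : NonUnitalNonAssocRing (TwistedGroupAlgebra lam)) with
    mul_assoc := fun f g h => by
      induction f using induction with
      | zero => simp only [zero_mul]
      | add f₁ f₂ h₁ h₂ => simp only [add_mul, h₁, h₂]
      | single a x =>
        induction g using induction with
        | zero => simp only [zero_mul, mul_zero]
        | add f₁ f₂ h₁ h₂ => simp only [add_mul, mul_add, h₁, h₂]
        | single b y =>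
          induction h using induction with
          | zero => simp only [mul_zero]
          | add f₁ f₂ h₁ h₂ => simp only [mul_add, h₁, h₂]
          | single c z =>
            simp only [single_mul_single, add_assoc]
            congr 1
            have h := congrArg (Units.val) (lam.cocycle a b c)
            simp only [Units.val_mul] at h
            linear_combination (x * y * z) * h
    one_mul := fun f => by
      induction f using induction with
      | zero => rw [mul_zero]
      | add f₁ f₂ h₁ h₂ => rw [mul_add, h₁, h₂]
      | single a x =>
        rw [one_eq, single_mul_single, zero_add, lam.zero_left a]
        congr 1
        rw [mul_right_comm, Units.inv_mul, one_mul]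
    mul_one := fun f => by
      induction f using induction with
      | zero => rw [zero_mul]
      | add f₁ f₂ h₁ h₂ => rw [add_mul, h₁, h₂]
      | single a x =>
        rw [one_eq, single_mul_single, add_zero, lam.zero_right a]
        congr 1
        rw [mul_assoc, Units.inv_mul, mul_one] }

/-- `K^t[G]` as an algebra over `K`, or over a subring of scalars `R` of `K`. -/
noncomputable instance {R : Type*} [CommRing R] [Algebra R K] :
    Algebra R (TwistedGroupAlgebra lam) :=
  Algebra.ofModule
    (fun r f g => by
      rw [← algebraMap_smul K r f, ← algebraMap_smul K r (f * g), mul_eq, mul_eq, map_smul,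
        LinearMap.smul_apply])
    (fun r f g => by
      rw [← algebraMap_smul K r g, ← algebraMap_smul K r (f * g), mul_eq, mul_eq, map_smul])

/-- The homogeneous component `K x^g`, as a space over `R`. -/
noncomputable def component (R : Type*) [CommRing R] [Algebra R K] (g : G) :
    Submodule R (TwistedGroupAlgebra lam) :=
  LinearMap.range (lsingle lam R g)

/-- The sign `(-1)^z` for `z ∈ 𝔽₂`. -/
def sign (K : Type*) [CommRing K] (z : ZMod 2) : K := (-1) ^ z.val

theorem sign_mul_sign (z t : ZMod 2) : sign K z * sign K t = sign K (z + t) := by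
  simp only [sign, ← pow_add, ZMod.val_add]
  exact neg_one_pow_eq_pow_mod_two _

theorem sign_mul_self (z : ZMod 2) : sign K z * sign K z = 1 := by
  rw [sign_mul_sign, CharTwo.add_self_eq_zero]
  simp [sign]

/-- The compatibility `(-1)^(q(a) + q(b) - q(a + b)) = lam(a, b) lam(b, a)⁻¹` of a quadratic map
`q : G → 𝔽₂` with `lam`. -/
def Compatible (q : QuadraticMap ℤ G (ZMod 2)) : Prop :=
  ∀ a b : G, sign K (q a + q b - q (a + b)) = ((lam a b * (lam b a)⁻¹ : Kˣ) : K)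

/-- The graded involution `θ_q` of `K^t[G]`, given by `θ_q(x^g) = (-1)^(q(g)) x^g`. -/
noncomputable def theta (q : QuadraticMap ℤ G (ZMod 2)) (hq : Compatible lam q) :
    AlgInvolution K (TwistedGroupAlgebra lam) where
  toLinearMap := lift lam fun g => single lam g (sign K (q g))
  map_mul_rev' f g := by
    change lift lam _ (f * g) = lift lam _ g * lift lam _ f
    induction f using induction with
    | zero => simp only [zero_mul, mul_zero, map_zero]
    | add f₁ f₂ h₁ h₂ => simp only [add_mul, mul_add, map_add, h₁, h₂]
    | single a x =>
      induction g using induction with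
      | zero => simp only [zero_mul, mul_zero, map_zero]
      | add f₁ f₂ h₁ h₂ => simp only [add_mul, mul_add, map_add, h₁, h₂]
      | single b y =>
        simp only [single_mul_single, lift_single, smul_single, smul_eq_mul]
        rw [add_comm b a]
        congr 1
        have h : (lam a b : K) = sign K (q a + q b - q (a + b)) * (lam b a : K) := by
          rw [hq a b, ← Units.val_mul, inv_mul_cancel_right]
        have h' : sign K (q a + q b - q (a + b)) * sign K (q (a + b)) = sign K (q a) * sign K (q b) := by
          rw [sign_mul_sign, sign_mul_sign, sub_add_cancel]
        rw [h]
        linear_combination (x * y * (lam b a : K)) * h'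
  involutive' f := by
    change lift lam _ (lift lam _ f) = f
    induction f using induction with
    | zero => simp only [map_zero]
    | add f₁ f₂ h₁ h₂ => rw [map_add, map_add, h₁, h₂]
    | single a x =>
      simp only [lift_single, smul_single, smul_eq_mul]
      rw [mul_assoc, sign_mul_self, mul_one]

end TwistedGroupAlgebra

/-! ### The three types and direct unions -/

section Types

variable {F : Type u} {A : Type v} [Field F] [Ring A] [Algebra F A]
variable {G : Type w} [AddCommGroup G]

/-- Involution type: `J` is graded isomorphic to `H((F^t[G], lam), θ_q)` for a `2`-cocycle `lam`
and a quadratic map `q : G → 𝔽₂`. -/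
def IsInvolutionType (V : Submodule F A) (𝒥 : G → Submodule F A) : Prop :=
  ∃ (lam : TwoCocycle G F) (q : QuadraticMap ℤ G (ZMod 2))
    (hq : TwistedGroupAlgebra.Compatible lam q),
    GradedJordanIso V 𝒥 (TwistedGroupAlgebra.theta lam q hq).H
      (fun g => TwistedGroupAlgebra.component lam F g ⊓ (TwistedGroupAlgebra.theta lam q hq).H)

/-- Plus type: `J` is graded isomorphic to `(F^t[G], lam)⁺` for a `2`-cocycle `lam`. -/
def IsPlusType (V : Submodule F A) (𝒥 : G → Submodule F A) : Prop :=
  ∃ lam : TwoCocycle G F,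
    GradedJordanIso V 𝒥 (⊤ : Submodule F (TwistedGroupAlgebra lam))
      (fun g => TwistedGroupAlgebra.component lam F g)

/-- Extension type: `J` is graded isomorphic to `H((E^t[G], lam), σ)`, where `E` is a quadratic
field extension of `F` with nontrivial automorphism `τ`, `lam : G × G → Eˣ` is a `2`-cocycle,
and `σ` is a `τ`-semilinear graded involution of the `F`-algebra `E^t[G]`. -/
def IsExtensionType (V : Submodule F A) (𝒥 : G → Submodule F A) : Prop :=
  ∃ (E : Type u) (_ : Field E) (_ : Algebra F E) (τ : E ≃ₐ[F] E) (lam : TwoCocycle G E)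
    (σ : AlgInvolution F (TwistedGroupAlgebra lam)),
    Module.finrank F E = 2 ∧ (∃ c : E, τ c ≠ c) ∧
    (∀ (c : E) (x : TwistedGroupAlgebra lam), σ (c • x) = τ c • σ x) ∧
    (∀ g : G, ∀ x ∈ TwistedGroupAlgebra.component lam F g,
      σ x ∈ TwistedGroupAlgebra.component lam F g) ∧
    GradedJordanIso V 𝒥 σ.H (fun g => TwistedGroupAlgebra.component lam F g ⊓ σ.H)

/-- `J = ⨁ J^g` is a direct union of Jordan tori with the property `T`: there is a nonempty
directed family of subgroups `H` of `G`, each free abelian of finite rank, such that each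
`J_H = ⨁_{g ∈ H} J^g` is a Jordan `H`-torus with the property `T`, and `J` is the union of
the `J_H`. -/
def IsDirectUnionOfTori (V : Submodule F A) (𝒥 : G → Submodule F A)
    (T : ∀ H : AddSubgroup G, Submodule F A → (H → Submodule F A) → Prop) : Prop :=
  ∃ 𝓗 : Set (AddSubgroup G), 𝓗.Nonempty ∧ DirectedOn (· ≤ ·) 𝓗 ∧
    (∀ H ∈ 𝓗, Module.Free ℤ H ∧ Module.Finite ℤ H ∧
      IsJordanTorus (gradedPart 𝒥 H) (restrictGrading 𝒥 H) ∧
      T H (gradedPart 𝒥 H) (restrictGrading 𝒥 H)) ∧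
    (V : Set A) = ⋃ H ∈ 𝓗, (gradedPart 𝒥 H : Set A)

end Types

/-! Two facts carry the argument. First, an element of `J` whose square is homogeneous of degree
`2g` is itself homogeneous of degree `g` (`IsJordanTorus.mem_of_mul_self_mem`), because in a
torsion-free group a finite set with at least two elements has two doubles that no other pair of its
elements reaches. Second, a monomial `p`, that is, a product of nonzero homogeneous elements, is
invertible in `P`, and `p * σ p` is homogeneous of twice its degree (`IsMonomial.mul_star_mem`).
Hence symmetric monomials are homogeneous elements of `J`, and monomials of degree zero have a
scalar norm.

The proof divides according to whether `P` contains a central skew `ε` with `ε² = d`, `d` a nonzero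
scalar (`HasCentralSkewRoot`).

If it does, multiplication by `ε` turns commutators of homogeneous elements into homogeneous
elements of `J`. So `P = J ⊕ εJ`, the support is all of `G`, and a homogeneous basis satisfies `x_a
x_b = (α + βε) x_{a+b}`. If `d` is not a square, then `ε` generates a quadratic extension field and
`P` is a twisted group algebra over it: extension type. If `d = r²`, replacing `ε` by `r` gives a
cocycle `α + βr` over `F`, and symmetrization gives plus type.

If it does not, the group commutator of two homogeneous elements is shown to be a scalar
(`IsJordanTorus.exists_commute_smul`), and `σ` forces it to be `±1`. Monomials are then symmetric or
skew, those of equal degree are proportional, and one monomial for each degree gives a copy of a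
twisted group algebra over `F` on which `σ` acts by signs. These signs define `q`: involution type.

For the direct unions, each type passes to subgroups of `G`, and the subgroups generated by finite
subsets of the support form the required family. -/

/-! ### Torsion-free abelian groups -/

/-- A finite subset with at least two elements of a torsion-free abelian group has two distinct
elements whose doubles are not otherwise sums of two elements of the subset. -/
theorem exists_two_unique_doubles {G : Type*} [AddCommGroup G] [IsAddTorsionFree G]
    (s : Finset G) (hs : 1 < s.card) :
    ∃ a ∈ s, ∃ b ∈ s, a ≠ b ∧ (∀ x ∈ s, ∀ y ∈ s, x + y = a + a → x = a ∧ y = a) ∧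
      (∀ x ∈ s, ∀ y ∈ s, x + y = b + b → x = b ∧ y = b) := by
  classical
  set H : AddSubgroup G := AddSubgroup.closure (s : Set G)
  have hsub : ∀ x ∈ s, x ∈ H := fun x hx => AddSubgroup.subset_closure hx
  -- Inside `H`, which is some `ℤⁿ` and so can be ordered, `TwoUniqueSums` holds.
  have : AddGroup.FG H := AddGroup.closure_finset_fg s
  have : AddMonoid.FG H := AddGroup.fg_iff_addMonoid_fg.1 inferInstance
  set t : Finset H := s.attach.image fun x => ⟨x.1, hsub x.1 x.2⟩
  have hmem : ∀ x : H, x ∈ t ↔ (x : G) ∈ s := by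
    intro x
    simp only [t, Finset.mem_image, Finset.mem_attach, true_and, Subtype.exists]
    constructor
    · rintro ⟨y, hy, rfl⟩
      exact hy
    · intro h
      exact ⟨x, h, rfl⟩
  have hcard : t.card = s.card := by
    rw [← Finset.card_attach (s := s)]
    exact Finset.card_image_of_injective _ fun x y h =>
      Subtype.ext (congrArg (fun z : H => (z : G)) h)
  have h1 : 1 < t.card * t.card := by
    rw [hcard]
    nlinarith
  obtain ⟨p, hp, q, hq, hpq, h1, h2⟩ := TwoUniqueSums.uniqueAdd_of_one_lt_card h1
  rw [Finset.mem_product] at hp hq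
  -- Swapping the summands gives the same sum, so a unique sum is a double.
  have key : ∀ r : H × H, r.1 ∈ t → r.2 ∈ t → UniqueAdd t t r.1 r.2 → r.1 = r.2 :=
    fun r h h' hu => (hu h' h (add_comm _ _)).2
  have hp' := key p hp.1 hp.2 h1
  have hq' := key q hq.1 hq.2 h2
  refine ⟨p.1, (hmem _).1 hp.1, q.1, (hmem _).1 hq.1, fun h => hpq ?_, ?_, ?_⟩
  · have : p.1 = q.1 := Subtype.ext h
    exact Prod.ext this (by rw [← hp', ← hq', this])
  · intro x hx y hy hxy
    have := @h1 ⟨x, hsub x hx⟩ ⟨y, hsub y hy⟩ ((hmem _).2 hx) ((hmem _).2 hy)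
      (by rw [← hp']; exact Subtype.ext hxy)
    exact ⟨congrArg Subtype.val this.1, by rw [hp']; exact congrArg Subtype.val this.2⟩
  · intro x hx y hy hxy
    have := @h2 ⟨x, hsub x hx⟩ ⟨y, hsub y hy⟩ ((hmem _).2 hx) ((hmem _).2 hy)
      (by rw [← hq']; exact Subtype.ext hxy)
    exact ⟨congrArg Subtype.val this.1, by rw [hq']; exact congrArg Subtype.val this.2⟩

/-! ### Jordan products -/

section JordanMul

variable {F A : Type*} [Field F] [Ring A] [Algebra F A]

theorem jordanMul_comm (x y : A) : jordanMul F x y = jordanMul F y x := by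
  rw [jordanMul, jordanMul, add_comm]

/-- The Jordan product, as a bilinear map. -/
noncomputable def jordanMulHom (F A : Type*) [Field F] [Ring A] [Algebra F A] : A →ₗ[F] A →ₗ[F] A :=
  (2⁻¹ : F) • (LinearMap.mul F A + (LinearMap.mul F A).flip)

theorem jordanMulHom_apply (x y : A) : jordanMulHom F A x y = jordanMul F x y := rfl

variable [CharZero F]

theorem two_smul_jordanMul (x y : A) : (2 : F) • jordanMul F x y = x * y + y * x := by
  rw [jordanMul, smul_smul, mul_inv_cancel₀ two_ne_zero, one_smul]

theorem jordanMul_of_commute {x y : A} (h : x * y = y * x) : jordanMul F x y = x * y := by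
  rw [jordanMul, ← h, ← two_smul F (x * y), smul_smul, inv_mul_cancel₀ two_ne_zero, one_smul]

theorem jordanMul_self (x : A) : jordanMul F x x = x * x := jordanMul_of_commute rfl

theorem one_jordanMul (x : A) : jordanMul F 1 x = x := by
  rw [jordanMul_of_commute (by rw [one_mul, mul_one]), one_mul]

/-- Multiplication by two is injective over a field of characteristic zero. -/
theorem eq_of_add_self_eq (F : Type*) {M : Type*} [Field F] [CharZero F] [AddCommGroup M]
    [Module F M] {x y : M} (h : x + x = y + y) : x = y := by
  rw [← two_smul F x, ← two_smul F y] at h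
  exact smul_right_injective M (two_ne_zero (α := F)) h

/-- Jordan inverses are two-sided inverses. -/
theorem mul_eq_one_of_jordan_inverse {x y : A} (h1 : jordanMul F x y = 1)
    (h2 : jordanMul F (jordanMul F x x) y = x) : x * y = 1 ∧ y * x = 1 := by
  have e1 : x * y + y * x = 1 + 1 := by
    rw [← two_smul_jordanMul (F := F), h1, two_smul]
  have e2 : x * x * y + y * (x * x) = x + x := by
    rw [jordanMul_self] at h2
    rw [← two_smul_jordanMul (F := F), h2, two_smul]
  have e3 : x * x * y + x * y * x = x + x := by
    have := congrArg (fun z => x * z) e1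
    simp only [mul_add, mul_one, ← mul_assoc] at this
    exact this
  have e4 : x * y * x + y * (x * x) = x + x := by
    have := congrArg (fun z => z * x) e1
    simp only [add_mul, one_mul, mul_assoc] at this
    rw [mul_assoc]
    exact this
  -- Comparing `e3` with `e2` gives `xyx = yx²`; then `e4` reads `2xyx = 2x`.
  have e5 : x * y * x = x := by
    apply eq_of_add_self_eq F
    have h : x * y * x = y * (x * x) := add_left_cancel (e3.trans e2.symm)
    calc x * y * x + x * y * x = x * y * x + y * (x * x) := by rw [← h]
      _ = x + x := e4
  -- Now `xy` and `2 - xy = yx` are both idempotent; expanding the square of the second leaves `2 =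
  -- 2xy`.
  have hf : y * x = 1 + 1 - x * y := by rw [← e1]; abel
  have i1 : x * y * (x * y) = x * y := by rw [← mul_assoc, e5]
  have i2 : y * x * (y * x) = y * x := by
    rw [mul_assoc, ← mul_assoc x, e5]
  have hxy : x * y = 1 := by
    apply eq_of_add_self_eq F
    have : (1 + 1 - x * y) * (1 + 1 - x * y) = 1 + 1 - x * y := by rw [← hf, i2]
    have h' : (1 + 1 - x * y) * (1 + 1 - x * y) = 1 + 1 + (1 + 1) - x * y - x * y - x * y - x * y
        + x * y * (x * y) := by noncomm_ring
    rw [h', i1] at this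
    have h3 : 1 + 1 - (x * y + x * y) = 0 := by
      rw [← sub_eq_zero] at this
      rw [← this]
      abel
    exact (sub_eq_zero.1 h3).symm
  refine ⟨hxy, ?_⟩
  rw [hf, hxy]
  abel

end JordanMul

/-! ### Involutions -/

namespace AlgInvolution

variable {F A : Type*} [Field F] [Ring A] [Algebra F A] (σ : AlgInvolution F A)

theorem map_mul (a b : A) : σ (a * b) = σ b * σ a := σ.map_mul_rev' a b

theorem involutive (a : A) : σ (σ a) = a := σ.involutive' a

theorem map_one : σ 1 = 1 := by
  have h := σ.map_mul (σ 1) 1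
  rw [mul_one, σ.involutive, mul_one] at h
  exact h.symm

theorem mem_H {a : A} : a ∈ σ.H ↔ σ a = a := Iff.rfl

/-- The symmetric part `(a + σ(a)) / 2`. -/
noncomputable def symmPart : A →ₗ[F] A := (2⁻¹ : F) • (LinearMap.id + σ.toLinearMap)

theorem symmPart_apply (a : A) : σ.symmPart a = (2⁻¹ : F) • (a + σ a) := rfl

theorem symmPart_mem (a : A) : σ.symmPart a ∈ σ.H := by
  rw [mem_H, symmPart_apply, map_smul, map_add, σ.involutive, add_comm]

/-- A central skew element with square zero vanishes if `A` is `σ`-prime. -/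
theorem IsPrime.eq_zero_of_central {σ : AlgInvolution F A} (hσ : σ.IsPrime) {k : A}
    (hk : σ k = -k) (hc : ∀ x, k * x = x * k) (h0 : k * k = 0) : k = 0 := by
  -- The ideal `kA` is `σ`-stable and has square zero.
  let I : TwoSidedIdeal A := TwoSidedIdeal.mk' {x | ∃ y, x = k * y} ⟨0, by rw [mul_zero]⟩
    (by rintro _ _ ⟨a, rfl⟩ ⟨b, rfl⟩; exact ⟨a + b, by rw [mul_add]⟩)
    (by rintro _ ⟨a, rfl⟩; exact ⟨-a, by rw [mul_neg]⟩)
    (by rintro x _ ⟨a, rfl⟩; exact ⟨x * a, by rw [← mul_assoc, ← hc, mul_assoc]⟩)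
    (by rintro _ y ⟨a, rfl⟩; exact ⟨a * y, by rw [mul_assoc]⟩)
  have hI : ∀ x, x ∈ I ↔ ∃ y, x = k * y := fun x => by
    simp only [I, TwoSidedIdeal.mem_mk', Set.mem_ofPred_eq]
  have hst : ∀ x ∈ I, σ x ∈ I := by
    intro x hx
    obtain ⟨y, rfl⟩ := (hI x).1 hx
    rw [hI]
    exact ⟨-σ y, by rw [σ.map_mul, hk, mul_neg, mul_neg, hc]⟩
  have hz : I = ⊥ := by
    refine (hσ.2 I I hst hst ?_).elim id id
    intro x hx y hy
    obtain ⟨a, rfl⟩ := (hI x).1 hx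
    obtain ⟨b, rfl⟩ := (hI y).1 hy
    rw [hc a, mul_assoc, ← mul_assoc k, h0, zero_mul, mul_zero]
  have hkI : k ∈ I := (hI k).2 ⟨1, (mul_one k).symm⟩
  rw [hz] at hkI
  exact (TwoSidedIdeal.mem_bot A).1 hkI

theorem symmPart_of_skew {a : A} (h : σ a = -a) : σ.symmPart a = 0 := by
  rw [symmPart_apply, h, add_neg_cancel, smul_zero]

variable [CharZero F]

theorem symmPart_of_symm {a : A} (h : σ a = a) : σ.symmPart a = a := by
  rw [symmPart_apply, h, ← two_smul F a, smul_smul, inv_mul_cancel₀ two_ne_zero, one_smul]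

end AlgInvolution

/-! ### Homogeneous elements of Jordan tori -/

/-- The projection onto a summand of an independent family, along the other ones. -/
theorem iSupIndep.exists_projection {F A G : Type*} [Field F] [AddCommGroup A] [Module F A]
    {𝒥 : G → Submodule F A} (h : iSupIndep 𝒥) (g : G) :
    ∃ π : A →ₗ[F] A, (∀ x ∈ 𝒥 g, π x = x) ∧ (∀ k ≠ g, ∀ x ∈ 𝒥 k, π x = 0) ∧
      ∀ x, π x ∈ 𝒥 g := by
  obtain ⟨b, hb, hc⟩ := (h g).symm.exists_isCompl
  refine ⟨(𝒥 g).projection b hc.symm, ?_, ?_, ?_⟩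
  · exact fun x hx => Submodule.projection_apply_of_mem_left _ hx
  · exact fun k hk x hx => (Submodule.projection_apply_eq_zero_iff _).2
      (hb ((le_iSup₂_of_le (f := fun j (_ : j ≠ g) => 𝒥 j) k hk le_rfl) hx))
  · exact fun x => Submodule.projection_apply_mem _ x

namespace IsJordanTorus

variable {F A G : Type*} [Field F] [Ring A] [Algebra F A] [AddCommGroup G]
  {V : Submodule F A} {𝒥 : G → Submodule F A}

section

variable (hJ : IsJordanTorus V 𝒥)

include hJ

theorem le (g : G) : 𝒥 g ≤ V := hJ.iSup_eq ▸ le_iSup 𝒥 g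

theorem exists_sum {y : A} (hy : y ∈ V) :
    ∃ f : G →₀ A, (∀ g, f g ∈ 𝒥 g) ∧ y = ∑ g ∈ f.support, f g := by
  rw [← hJ.iSup_eq, Submodule.mem_iSup_iff_exists_finsupp] at hy
  obtain ⟨f, hf, h⟩ := hy
  exact ⟨f, hf, h.symm⟩

theorem exists_smul {g : G} {x y : A} (hx : x ∈ 𝒥 g) (hx0 : x ≠ 0) (hy : y ∈ 𝒥 g) :
    ∃ c : F, y = c • x := by
  obtain ⟨v, hv⟩ := (rank_submodule_le_one_iff' (𝒥 g)).1 (hJ.rank_le_one g)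
  obtain ⟨a, rfl⟩ := Submodule.mem_span_singleton.1 (hv hx)
  obtain ⟨b, rfl⟩ := Submodule.mem_span_singleton.1 (hv hy)
  have ha : a ≠ 0 := fun h => hx0 (by rw [h, zero_smul])
  exact ⟨b * a⁻¹, by rw [smul_smul, inv_mul_cancel_right₀ ha]⟩

variable [CharZero F]

/-- Comparing components of degree `a` in `1 ∘ x = x` shows that the degree-zero component of `1`
acts as the identity on every `𝒥 a`, hence on `1`. -/
theorem one_mem_zero : (1 : A) ∈ 𝒥 0 := by
  obtain ⟨f, hf, h1⟩ := hJ.exists_sum hJ.one_mem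
  have key : ∀ a, ∀ x ∈ 𝒥 a, jordanMul F (f 0) x = x := by
    intro a x hx
    obtain ⟨π, h, h', -⟩ := hJ.indep.exists_projection a
    have e1 : jordanMulHom F A 1 x = x := one_jordanMul x
    rw [h1, map_sum, LinearMap.sum_apply] at e1
    have e2 := congrArg π e1
    rw [h x hx, map_sum, Finset.sum_eq_single 0] at e2
    · rw [← jordanMulHom_apply]
      rw [h] at e2
      · exact e2
      · have := hJ.mul_mem 0 a _ (hf 0) x hx
        rwa [zero_add] at this
    · intro b _ hb
      exact h' (b + a) (by simpa using hb) _ (hJ.mul_mem b a _ (hf b) x hx)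
    · intro h0
      rw [Finsupp.notMem_support_iff.1 h0, map_zero, LinearMap.zero_apply, map_zero]
  have hV : ∀ v ∈ V, jordanMul F (f 0) v = v := by
    intro v hv
    have : V ≤ LinearMap.eqLocus (jordanMulHom F A (f 0)) LinearMap.id := by
      rw [← hJ.iSup_eq, iSup_le_iff]
      exact fun a x hx => key a x hx
    exact this hv
  have := hV 1 hJ.one_mem
  rw [jordanMul_comm, one_jordanMul] at this
  rw [← this]
  exact hf 0

theorem mem_zero [Nontrivial A] {y : A} (hy : y ∈ 𝒥 0) : ∃ c : F, y = c • (1 : A) :=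
  hJ.exists_smul hJ.one_mem_zero one_ne_zero hy

/-- Projecting the two equations of a Jordan inverse to degrees `0` and `a` shows that its component
of degree `-a` already satisfies them. -/
theorem exists_inv {a : G} {x : A} (hx : x ∈ 𝒥 a) (hx0 : x ≠ 0) :
    ∃ y ∈ 𝒥 (-a), x * y = 1 ∧ y * x = 1 := by
  obtain ⟨y, hy, h1, h2⟩ := hJ.invertible a x hx hx0
  obtain ⟨f, hf, rfl⟩ := hJ.exists_sum hy
  refine ⟨f (-a), hf _, mul_eq_one_of_jordan_inverse (F := F) ?_ ?_⟩
  · obtain ⟨π, h, h', -⟩ := hJ.indep.exists_projection 0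
    rw [← jordanMulHom_apply, map_sum] at h1
    have e2 := congrArg π h1
    rw [h 1 hJ.one_mem_zero, map_sum, Finset.sum_eq_single (-a)] at e2
    · rw [h] at e2
      · exact e2
      · have := hJ.mul_mem _ _ x hx _ (hf (-a))
        rwa [add_neg_cancel] at this
    · intro b _ hb
      exact h' (a + b) (fun h => hb (eq_neg_of_add_eq_zero_right h)) _
        (hJ.mul_mem a b x hx _ (hf b))
    · intro h0
      rw [Finsupp.notMem_support_iff.1 h0, map_zero, map_zero]
  · obtain ⟨π, h, h', -⟩ := hJ.indep.exists_projection a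
    have hxx := hJ.mul_mem _ _ x hx x hx
    rw [← jordanMulHom_apply, map_sum] at h2
    have e2 := congrArg π h2
    rw [h x hx, map_sum, Finset.sum_eq_single (-a)] at e2
    · rw [h] at e2
      · exact e2
      · have := hJ.mul_mem _ _ _ hxx _ (hf (-a))
        rwa [add_neg_cancel_right] at this
    · intro b _ hb
      refine h' (a + a + b) (fun h => hb ?_) _ (hJ.mul_mem _ b _ hxx _ (hf b))
      rw [add_assoc] at h
      exact eq_neg_of_add_eq_zero_right (add_eq_left.1 h)
    · intro h0
      rw [Finsupp.notMem_support_iff.1 h0, map_zero, map_zero]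

/-- This is the quadratic operator of the Jordan algebra: `xyx = 2 x ∘ (x ∘ y) - x² ∘ y`. -/
theorem mul_mul_mem {a b : G} {x y : A} (hx : x ∈ 𝒥 a) (hy : y ∈ 𝒥 b) :
    x * y * x ∈ 𝒥 (a + (a + b)) := by
  have h1 := hJ.mul_mem _ _ x hx _ (hJ.mul_mem _ _ x hx y hy)
  have h2 := hJ.mul_mem _ _ _ (hJ.mul_mem _ _ x hx x hx) y hy
  rw [add_assoc] at h2
  have h3 := Submodule.sub_mem _ (Submodule.smul_mem _ (2 : F) h1) h2
  convert h3 using 1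
  rw [jordanMul_self]
  apply eq_of_add_self_eq F
  rw [← two_smul F (_ - _), smul_sub, two_smul_jordanMul, two_smul_jordanMul, smul_add,
    ← mul_smul_comm, ← smul_mul_assoc, two_smul_jordanMul]
  noncomm_ring

theorem mul_self_ne_zero [Nontrivial A] {a : G} {x : A} (hx : x ∈ 𝒥 a) (hx0 : x ≠ 0) :
    x * x ≠ 0 := by
  obtain ⟨y, -, h1, -⟩ := hJ.exists_inv hx hx0
  intro h
  apply hx0
  rw [← mul_one x, ← h1, ← mul_assoc, h, zero_mul]

theorem mul_self_mem {a : G} {x : A} (hx : x ∈ 𝒥 a) : x * x ∈ 𝒥 (a + a) := by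
  have := hJ.mul_mem _ _ x hx x hx
  rwa [jordanMul_self] at this

/-- An element of a Jordan torus whose square is homogeneous is homogeneous. -/
theorem mem_of_mul_self_mem [IsAddTorsionFree G] [Nontrivial A] {g : G} {y : A} (hy : y ∈ V)
    (h : y * y ∈ 𝒥 (g + g)) : y ∈ 𝒥 g := by
  obtain ⟨f, hf, rfl⟩ := hJ.exists_sum hy
  -- At a double `a + a` reached by no other pair, the component of the square is `(f a)²`, which is
  -- nonzero; a homogeneous square must have this degree.
  have hsq : ∀ k, jordanMul F (∑ g ∈ f.support, f g) (∑ g ∈ f.support, f g) ∈ 𝒥 k →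
      ∀ a ∈ f.support, (∀ x ∈ f.support, ∀ y ∈ f.support, x + y = a + a → x = a ∧ y = a) →
      k = a + a := by
    intro k hk a ha hu
    by_contra hne
    obtain ⟨π, h1, h2, -⟩ := hJ.indep.exists_projection (a + a)
    have h3 := h2 k hne _ hk
    rw [← jordanMulHom_apply, map_sum (jordanMulHom F A), LinearMap.sum_apply, map_sum,
      Finset.sum_eq_single a, map_sum, map_sum, Finset.sum_eq_single a] at h3
    · rw [jordanMulHom_apply, h1 _ (hJ.mul_mem _ _ _ (hf a) _ (hf a)), jordanMul_self] at h3
      exact hJ.mul_self_ne_zero (hf a) (Finsupp.mem_support_iff.1 ha) h3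
    · intro b hb hba
      exact h2 (a + b) (fun h => hba (hu a ha b hb h).2) _ (hJ.mul_mem _ _ _ (hf a) _ (hf b))
    · exact fun h => absurd ha h
    · intro b hb hba
      rw [map_sum, map_sum]
      refine Finset.sum_eq_zero fun c hc => ?_
      exact h2 (b + c) (fun h => hba (hu b hb c hc h).1) _ (hJ.mul_mem _ _ _ (hf b) _ (hf c))
    · exact fun h => absurd ha h
  rw [← jordanMul_self (F := F)] at h
  rcases lt_or_ge 1 f.support.card with h1 | h1
  · obtain ⟨a, ha, b, hb, hab, hua, hub⟩ := exists_two_unique_doubles _ h1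
    have e := (hsq _ h a ha hua).symm.trans (hsq _ h b hb hub)
    rw [← two_nsmul, ← two_nsmul] at e
    exact absurd (nsmul_right_injective two_ne_zero e) hab
  · rcases Nat.le_one_iff_eq_zero_or_eq_one.1 h1 with h0 | h0
    · rw [Finset.card_eq_zero.1 h0, Finset.sum_empty]
      exact Submodule.zero_mem _
    · obtain ⟨a, ha⟩ := Finset.card_eq_one.1 h0
      have hm : a ∈ f.support := by rw [ha]; exact Finset.mem_singleton_self a
      have e := hsq _ h a hm fun x hx y hy _ => by
        rw [ha, Finset.mem_singleton] at hx hy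
        exact ⟨hx, hy⟩
      rw [← two_nsmul, ← two_nsmul] at e
      rw [nsmul_right_injective two_ne_zero e, ha, Finset.sum_singleton]
      exact hf a

theorem exists_mem_ne_zero_neg {a : G} (h : 𝒥 a ≠ ⊥) [Nontrivial A] : 𝒥 (-a) ≠ ⊥ := by
  obtain ⟨x, hx, hx0⟩ := (Submodule.ne_bot_iff _).1 h
  obtain ⟨y, hy, h1, -⟩ := hJ.exists_inv hx hx0
  exact (Submodule.ne_bot_iff _).2 ⟨y, hy, fun h => one_ne_zero (by rw [← h1, h, mul_zero])⟩

end

end IsJordanTorus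

/-! ### Monomials in homogeneous elements -/

/-- `p` is a product of nonzero homogeneous elements whose degrees add up to `g`. -/
inductive IsMonomial {F A G : Type*} [Field F] [Ring A] [Algebra F A] [AddCommGroup G]
    (𝒥 : G → Submodule F A) : G → A → Prop
  | one : IsMonomial 𝒥 0 1
  | mul {a g : G} {x p : A} : x ∈ 𝒥 a → x ≠ 0 → IsMonomial 𝒥 g p → IsMonomial 𝒥 (a + g) (x * p)

/-- `A` contains a central skew element whose square is a nonzero scalar. -/
def AlgInvolution.HasCentralSkewRoot {F A : Type*} [Field F] [Ring A] [Algebra F A]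
    (σ : AlgInvolution F A) : Prop :=
  ∃ (ε : A) (d : F), σ ε = -ε ∧ (∀ x, ε * x = x * ε) ∧ d ≠ 0 ∧ ε * ε = d • (1 : A)

namespace IsMonomial

variable {F A G : Type*} [Field F] [Ring A] [Algebra F A] [AddCommGroup G]
  {𝒥 : G → Submodule F A}

theorem of_mem {a : G} {x : A} (hx : x ∈ 𝒥 a) (hx0 : x ≠ 0) : IsMonomial 𝒥 a x := by
  have := IsMonomial.mul hx hx0 IsMonomial.one
  rwa [add_zero, mul_one] at this

theorem mul_mono {g h : G} {p q : A} (hp : IsMonomial 𝒥 g p) (hq : IsMonomial 𝒥 h q) :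
    IsMonomial 𝒥 (g + h) (p * q) := by
  induction hp with
  | one => rwa [zero_add, one_mul]
  | mul hx hx0 _ ih =>
    rw [add_assoc, mul_assoc]
    exact IsMonomial.mul hx hx0 ih

variable {σ : AlgInvolution F A} (hJ : IsJordanTorus σ.H 𝒥)

include hJ

theorem _root_.IsJordanTorus.symm {a : G} {x : A} (hx : x ∈ 𝒥 a) : σ x = x := hJ.le a hx

theorem star {g : G} {p : A} (hp : IsMonomial 𝒥 g p) : IsMonomial 𝒥 g (σ p) := by
  induction hp with
  | one => rw [σ.map_one]; exact IsMonomial.one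
  | mul hx hx0 _ ih =>
    rw [σ.map_mul, hJ.symm hx, add_comm]
    exact ih.mul_mono (of_mem hx hx0)

/-- An element which commutes with the homogeneous elements of `H(A, σ)` is central if `H(A, σ)`
generates `A`. -/
theorem _root_.IsJordanTorus.central_of_commute (hgen : Algebra.adjoin F (σ.H : Set A) = ⊤) {p : A}
    (h : ∀ a, ∀ x ∈ 𝒥 a, p * x = x * p) (y : A) : p * y = y * p := by
  have h1 : σ.H ≤ Subalgebra.toSubmodule (Subalgebra.centralizer F {p}) := by
    rw [← hJ.iSup_eq, iSup_le_iff]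
    intro a x hx
    rw [Subalgebra.mem_toSubmodule, Subalgebra.mem_centralizer_iff]
    rintro _ rfl
    exact h a x hx
  have h2 : (⊤ : Subalgebra F A) ≤ Subalgebra.centralizer F {p} := by
    rw [← hgen]
    exact Algebra.adjoin_le h1
  exact (Subalgebra.mem_centralizer_iff F).1 (h2 (Algebra.mem_top (x := y))) p rfl

variable [CharZero F]

/-- Each factor `x` of `p` acts through `x _ x`, which preserves `J`. Monomials thus act on `J`
without belonging to it. -/
theorem mul_mul_star_mem {g b : G} {p y : A} (hp : IsMonomial 𝒥 g p) (hy : y ∈ 𝒥 b) :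
    p * y * σ p ∈ 𝒥 (g + g + b) := by
  induction hp with
  | one => rwa [σ.map_one, one_mul, mul_one, add_zero, zero_add]
  | @mul a g x p hx hx0 _ ih =>
    rw [σ.map_mul, hJ.symm hx]
    have h1 : x * p * y * (σ p * x) = x * (p * y * σ p) * x := by noncomm_ring
    have h2 : a + g + (a + g) + b = a + (a + (g + g + b)) := by abel
    rw [h1, h2]
    exact hJ.mul_mul_mem hx ih

theorem mul_star_mem {g : G} {p : A} (hp : IsMonomial 𝒥 g p) : p * σ p ∈ 𝒥 (g + g) := by
  have := hp.mul_mul_star_mem hJ hJ.one_mem_zero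
  rwa [mul_one, add_zero] at this

/-! ### Norms and commutators of monomials -/

variable [Nontrivial A]

theorem exists_inv {g : G} {p : A} (hp : IsMonomial 𝒥 g p) :
    ∃ q, IsMonomial 𝒥 (-g) q ∧ p * q = 1 ∧ q * p = 1 := by
  induction hp with
  | one => exact ⟨1, by rw [neg_zero]; exact IsMonomial.one, mul_one 1, mul_one 1⟩
  | @mul a g x p hx hx0 _ ih =>
    obtain ⟨q, hq, h1, h2⟩ := ih
    obtain ⟨y, hy, h3, h4⟩ := hJ.exists_inv hx hx0
    have hy0 : y ≠ 0 := fun h => one_ne_zero (by rw [← h3, h, mul_zero])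
    refine ⟨q * y, ?_, ?_, ?_⟩
    · rw [neg_add_rev]
      exact hq.mul_mono (of_mem hy hy0)
    · rw [mul_assoc, ← mul_assoc p, h1, one_mul, h3]
    · rw [mul_assoc, ← mul_assoc y, h4, one_mul, h2]

theorem ne_zero {g : G} {p : A} (hp : IsMonomial 𝒥 g p) : p ≠ 0 := by
  obtain ⟨q, -, h, -⟩ := hp.exists_inv hJ
  exact fun h0 => one_ne_zero (by rw [← h, h0, zero_mul])

/-- Here `p * p = p * σ p` is homogeneous of degree `g + g`. -/
theorem mem_of_symm [IsAddTorsionFree G] {g : G} {p : A} (hp : IsMonomial 𝒥 g p) (h : σ p = p) :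
    p ∈ 𝒥 g := by
  apply hJ.mem_of_mul_self_mem h
  have := hp.mul_star_mem hJ
  rwa [h] at this

theorem exists_smul_of_zero_symm [IsAddTorsionFree G] {p : A} (hp : IsMonomial 𝒥 0 p)
    (h : σ p = p) : ∃ c : F, p = c • (1 : A) :=
  hJ.mem_zero (hp.mem_of_symm hJ h)

/-- `p * σ p` lies in `𝒥 0`, the line of scalars, and is invertible. The opposite product is the
same scalar because `σ p` is `n` times the inverse of `p`. -/
theorem exists_norm {p : A} (hp : IsMonomial 𝒥 0 p) :
    ∃ n : F, n ≠ 0 ∧ p * σ p = n • (1 : A) ∧ σ p * p = n • (1 : A) := by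
  have h := hp.mul_star_mem hJ
  rw [add_zero] at h
  obtain ⟨n, hn⟩ := hJ.mem_zero h
  have hn0 : n ≠ 0 := by
    rintro rfl
    rw [zero_smul] at hn
    exact (hp.mul_mono (hp.star hJ)).ne_zero hJ hn
  refine ⟨n, hn0, hn, ?_⟩
  obtain ⟨q, -, h1, h2⟩ := hp.exists_inv hJ
  have : σ p = n • q := by
    rw [← one_mul (σ p), ← h2, mul_assoc, hn, mul_smul_comm, mul_one]
  rw [this, smul_mul_assoc, h2]

/-- Monomials of degree zero commute up to scalars with homogeneous elements. -/
theorem exists_commute {b : G} {p x : A} (hp : IsMonomial 𝒥 0 p) (hx : x ∈ 𝒥 b) (hx0 : x ≠ 0) :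
    ∃ c : F, c ≠ 0 ∧ p * x = c • (x * p) := by
  obtain ⟨n, hn0, h1, h2⟩ := hp.exists_norm hJ
  -- The map `x ↦ p x σ(p)` preserves the line `𝒥 b`; multiplying by `p` on the right replaces `σ(p)
  -- p` by `n`.
  have h := hp.mul_mul_star_mem hJ hx
  rw [add_zero, zero_add] at h
  obtain ⟨c, hc⟩ := hJ.exists_smul hx hx0 h
  have e : n • (p * x) = c • (x * p) := by
    rw [← smul_mul_assoc c, ← hc, mul_assoc, h2, mul_smul_comm, mul_one]
  have hpx : p * x = (n⁻¹ * c) • (x * p) := by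
    rw [mul_smul, ← e, smul_smul, inv_mul_cancel₀ hn0, one_smul]
  refine ⟨n⁻¹ * c, ?_, hpx⟩
  intro h0
  rw [h0, zero_smul] at hpx
  exact (hp.mul_mono (of_mem hx hx0)).ne_zero hJ hpx

omit [CharZero F] [Nontrivial A] hJ in
theorem smul_left_cancel_of_ne_zero {x : A} (hx : x ≠ 0) {c d : F} (h : c • x = d • x) : c = d := by
  rw [← sub_eq_zero, ← sub_smul] at h
  exact sub_eq_zero.1 ((smul_eq_zero.1 h).resolve_right hx)

/-- A skew monomial of degree zero is scalar or central. -/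
theorem scalar_or_central [IsAddTorsionFree G] {p : A} (hp : IsMonomial 𝒥 0 p) (hs : σ p = -p) :
    (∃ c : F, p = c • (1 : A)) ∨ ∀ a, ∀ x ∈ 𝒥 a, p * x = x * p := by
  by_contra hcon
  rw [not_or] at hcon
  obtain ⟨h1, h2⟩ := hcon
  apply h2
  intro a x hx
  by_cases hx0 : x = 0
  · rw [hx0, mul_zero, zero_mul]
  obtain ⟨c, hc0, hc⟩ := hp.exists_commute hJ hx hx0
  have hxp := (of_mem hx hx0).mul_mono hp
  -- `σ` turns `px = c xp` into `xp = c px`, so `c = ±1`.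
  have h3 : x * p = c • (p * x) := by
    have := congrArg σ.toLinearMap hc
    rw [map_smul, σ.map_mul, σ.map_mul, hs, hJ.symm hx, mul_neg, neg_mul, smul_neg, neg_inj] at this
    exact this
  have h4 : c * c = 1 := by
    apply smul_left_cancel_of_ne_zero (hxp.ne_zero hJ)
    rw [mul_smul, ← hc, ← h3, one_smul]
  rcases mul_self_eq_one_iff.1 h4 with rfl | rfl
  · rw [hc, one_smul]
  · exfalso
    apply h1
    -- Anticommutation makes `xp` symmetric, hence a multiple of `x`; cancelling `x` makes `p`
    -- scalar.
    have h5 : x * p ∈ 𝒥 a := by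
      have := hxp.mem_of_symm hJ (by
        rw [σ.map_mul, hs, hJ.symm hx, neg_mul, hc, neg_smul, one_smul, neg_neg])
      rwa [add_zero] at this
    obtain ⟨d, hd⟩ := hJ.exists_smul hx hx0 h5
    obtain ⟨y, -, -, hy⟩ := hJ.exists_inv hx hx0
    refine ⟨d, ?_⟩
    rw [← one_mul p, ← hy, mul_assoc, hd, mul_smul_comm]

/-- If there is no central skew square root of a scalar, the commutator of two homogeneous
elements is a scalar. -/
theorem _root_.IsJordanTorus.exists_commute_smul [IsAddTorsionFree G] (hprime : σ.IsPrime)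
    (hgen : Algebra.adjoin F (σ.H : Set A) = ⊤) (hII : ¬ σ.HasCentralSkewRoot)
    {a b : G} {x y : A} (hx : x ∈ 𝒥 a) (hx0 : x ≠ 0) (hy : y ∈ 𝒥 b) (hy0 : y ≠ 0) :
    ∃ c : F, x * y = c • (y * x) := by
  obtain ⟨x', hx', hxx', hx'x⟩ := hJ.exists_inv hx hx0
  obtain ⟨y', hy', hyy', hy'y⟩ := hJ.exists_inv hy hy0
  have hx'0 : x' ≠ 0 := fun h => one_ne_zero (by rw [← hxx', h, mul_zero])
  have hy'0 : y' ≠ 0 := fun h => one_ne_zero (by rw [← hyy', h, mul_zero])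
  -- `t` is the group commutator of `x` and `y`, a monomial of degree zero.
  obtain ⟨t, ht⟩ : ∃ t, t = x * y * (x' * y') := ⟨_, rfl⟩
  have htm : IsMonomial 𝒥 0 t := by
    have := ((of_mem hx hx0).mul_mono (of_mem hy hy0)).mul_mono
      ((of_mem hx' hx'0).mul_mono (of_mem hy' hy'0))
    rw [← ht] at this
    convert this using 1
    abel
  have htx : x * y = t * (y * x) := by
    rw [ht, mul_assoc, mul_assoc x', ← mul_assoc y', hy'y, one_mul, hx'x, mul_one]
  suffices h : ∃ c : F, t = c • (1 : A) by
    obtain ⟨c, rfl⟩ := h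
    exact ⟨c, by rw [htx, smul_mul_assoc, one_mul]⟩
  by_cases hsym : σ t = t
  · exact htm.exists_smul_of_zero_symm hJ hsym
  obtain ⟨n, hn0, hn1, hn2⟩ := htm.exists_norm hJ
  obtain ⟨c, hc0, hc⟩ := htm.exists_commute hJ hx hx0
  have hw := (of_mem hx hx0).mul_mono ((of_mem hy hy0).mul_mono (of_mem hx hx0))
  -- Both `x² ∘ y` and `xyx` lie in the line of degree `2a + b`. Since `x²y = c⁻¹ t xyx` and `yx² =
  -- n⁻¹ σ(t) xyx`, cancelling `xyx` gives a linear relation between `t` and `σ t`.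
  obtain ⟨α, hα⟩ : ∃ α : F, c⁻¹ • t + n⁻¹ • σ t = α • (1 : A) := by
    have h1 : x * (y * x) ∈ 𝒥 (a + a + b) := by
      have := hJ.mul_mul_mem hx hy
      rwa [mul_assoc, ← add_assoc] at this
    obtain ⟨α, hα⟩ := hJ.exists_smul h1 (hw.ne_zero hJ) (hJ.mul_mem _ _ _ (hJ.mul_self_mem hx) y hy)
    have h2 : x * x * y = c⁻¹ • (t * (x * (y * x))) := by
      rw [← mul_assoc t, hc, smul_mul_assoc, smul_smul, inv_mul_cancel₀ hc0, one_smul, mul_assoc,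
        htx, mul_assoc]
    have h3 : y * (x * x) = n⁻¹ • (σ t * (x * (y * x))) := by
      have : σ t * (x * (y * x)) = n • (y * (x * x)) := by
        rw [← mul_assoc x, htx, ← mul_assoc, ← mul_assoc, hn2, smul_mul_assoc, smul_mul_assoc,
          one_mul, mul_assoc]
      rw [this, smul_smul, inv_mul_cancel₀ hn0, one_smul]
    have h4 : (c⁻¹ • t + n⁻¹ • σ t) * (x * (y * x)) = ((2 : F) * α) • (x * (y * x)) := by
      rw [add_mul, smul_mul_assoc, smul_mul_assoc, ← h2, ← h3, ← two_smul_jordanMul (F := F), hα,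
        smul_smul]
    obtain ⟨w, -, hw1, -⟩ := hw.exists_inv hJ
    refine ⟨2 * α, ?_⟩
    rw [← mul_one (_ + _), ← hw1, ← mul_assoc, h4, smul_mul_assoc]
  have hα' : c⁻¹ • σ t + n⁻¹ • t = α • (1 : A) := by
    have := congrArg σ.toLinearMap hα
    rwa [map_add, map_smul, map_smul, map_smul, σ.involutive, σ.map_one] at this
  -- The relation and its image under `σ` differ by `(c⁻¹ - n⁻¹)(t - σ t)`, and `t ≠ σ t`. So `t`
  -- has a scalar trace `β` as well as a scalar norm `n`.
  have hcn : c⁻¹ = n⁻¹ := by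
    have h1 : (c⁻¹ - n⁻¹) • (t - σ t) = 0 := by
      have h2 : (c⁻¹ - n⁻¹) • (t - σ t) = c⁻¹ • t + n⁻¹ • σ t - (c⁻¹ • σ t + n⁻¹ • t) := by
        module
      rw [h2, hα, hα', sub_self]
    rcases smul_eq_zero.1 h1 with h | h
    · exact sub_eq_zero.1 h
    · exact absurd (sub_eq_zero.1 h).symm hsym
  obtain ⟨β, hβ⟩ : ∃ β : F, σ t = β • (1 : A) - t := by
    refine ⟨n * α, ?_⟩
    rw [mul_smul, ← hα, hcn, smul_add, smul_smul, smul_smul, mul_inv_cancel₀ hn0, one_smul,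
      one_smul, add_sub_cancel_left]
  by_cases hcen : ∀ a, ∀ x ∈ 𝒥 a, t * x = x * t
  -- If `t` is central, then `t - σ t` is central and skew, with square the discriminant `β² - 4n`.
  -- Zero contradicts primeness, and a nonzero value contradicts `hII`.
  · have hct := hJ.central_of_commute hgen hcen
    have hks : σ (t - σ t) = -(t - σ t) := by rw [map_sub, σ.involutive, neg_sub]
    have hkc : ∀ x, (t - σ t) * x = x * (t - σ t) := by
      intro x
      rw [hβ, sub_mul, mul_sub, sub_mul, mul_sub, hct, smul_mul_assoc, one_mul, mul_smul_comm,
        mul_one]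
    have hk2 : (t - σ t) * (t - σ t) = (β * β - 4 * n) • (1 : A) := by
      have h1 : (t - σ t) * (t - σ t) = (t + σ t) * (t + σ t) - (2 : F) • (t * σ t)
          - (2 : F) • (σ t * t) := by
        rw [two_smul, two_smul]
        noncomm_ring
      have h2 : t + σ t = β • (1 : A) := by rw [hβ, add_sub_cancel]
      rw [h1, h2, hn1, hn2, smul_mul_assoc, one_mul]
      module
    by_cases hd : β * β - 4 * n = 0
    · rw [hd, zero_smul] at hk2
      exact absurd (sub_eq_zero.1 (hprime.eq_zero_of_central hks hkc hk2)).symm hsym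
    · exact absurd ⟨_, _, hks, hkc, hd, hk2⟩ hII
  · push Not at hcen
    obtain ⟨e, z, hz, hne⟩ := hcen
    have hz0 : z ≠ 0 := by
      rintro rfl
      exact hne (by rw [mul_zero, zero_mul])
    -- Comparing `tz = c' zt` with its image under `σ` gives `(c'² - 1) t = (c' - 1) β`, where `c' ≠
    -- 1`.
    obtain ⟨c', -, hc'⟩ := htm.exists_commute hJ hz hz0
    obtain ⟨z', -, -, hz'⟩ := hJ.exists_inv hz hz0
    have h1 : z * σ t = c' • (σ t * z) := by
      have := congrArg σ.toLinearMap hc'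
      rwa [map_smul, σ.map_mul, σ.map_mul, hJ.symm hz] at this
    have h2 : z * (β • (1 : A) - t) = z * ((c' * β) • (1 : A) - (c' * c') • t) := by
      rw [← hβ, h1, hβ, sub_mul, hc', smul_mul_assoc, one_mul, mul_sub, mul_smul_comm,
        mul_smul_comm, mul_one]
      module
    have h3 : β • (1 : A) - t = (c' * β) • (1 : A) - (c' * c') • t := by
      have := congrArg (fun u => z' * u) h2
      simpa only [← mul_assoc, hz', one_mul] using this
    have hc1 : c' - 1 ≠ 0 := by
      intro h
      rw [sub_eq_zero.1 h, one_smul] at hc'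
      exact hne hc'
    have h4 : (c' + 1) • t = β • (1 : A) := by
      apply smul_right_injective A hc1
      have : (c' - 1) • (c' + 1) • t - (c' - 1) • β • (1 : A)
          = (β • (1 : A) - t) - ((c' * β) • (1 : A) - (c' * c') • t) := by module
      exact sub_eq_zero.1 (this.trans (sub_eq_zero.2 h3))
    -- If `c' = -1`, the trace vanishes and `t` is skew, so `scalar_or_central` applies; otherwise
    -- `t = β / (c' + 1)`.
    by_cases hc2 : c' + 1 = 0
    · have hβ0 : β • (1 : A) = 0 := by rw [← h4, hc2, zero_smul]
      rw [hβ0, zero_sub] at hβ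
      exact (htm.scalar_or_central hJ hβ).resolve_right fun h => hne (h e z hz)
    · refine ⟨(c' + 1)⁻¹ * β, ?_⟩
      rw [mul_smul, ← h4, smul_smul, inv_mul_cancel₀ hc2, one_smul]

end IsMonomial

/-! ### Graded isomorphisms of Jordan algebras -/

section GradedIso

variable {F A B G : Type*} [Field F] [Ring A] [Algebra F A] [Ring B] [Algebra F B]

/-- A graded linear bijection which preserves Jordan products is a graded isomorphism. -/
theorem GradedJordanIso.of_linearMap {V : Submodule F A} {𝒥 : G → Submodule F A}
    {W : Submodule F B} {𝒦 : G → Submodule F B} (hV : ⨆ g, 𝒥 g = V) (hW : ⨆ g, 𝒦 g = W)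
    (hWmul : ∀ x ∈ W, ∀ y ∈ W, jordanMul F x y ∈ W) (Ψ : W →ₗ[F] A) (hinj : Function.Injective Ψ)
    (hmul : ∀ x y z : W, (z : B) = jordanMul F (x : B) (y : B) → Ψ z = jordanMul F (Ψ x) (Ψ y))
    (hmap : ∀ g a, a ∈ 𝒥 g ↔ ∃ x : W, (x : B) ∈ 𝒦 g ∧ Ψ x = a) : GradedJordanIso V 𝒥 W 𝒦 := by
  have hle : ∀ g, 𝒦 g ≤ W := fun g => hW ▸ le_iSup 𝒦 g
  have hrange : LinearMap.range Ψ = V := by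
    apply le_antisymm
    · rintro _ ⟨x, rfl⟩
      obtain ⟨f, hf, hx⟩ := (Submodule.mem_iSup_iff_exists_finsupp 𝒦 (x : B)).1 (hW.symm ▸ x.2)
      have hx' : x = ∑ g ∈ f.support, ⟨f g, hle g (hf g)⟩ := by
        apply Subtype.ext
        rw [← hx, AddSubmonoidClass.coe_finsetSum]
        rfl
      rw [hx', map_sum]
      refine Submodule.sum_mem _ fun g _ => ?_
      rw [← hV]
      exact le_iSup 𝒥 g ((hmap g _).2 ⟨_, hf g, rfl⟩)
    · rw [← hV, iSup_le_iff]
      intro g a ha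
      obtain ⟨x, -, rfl⟩ := (hmap g a).1 ha
      exact ⟨x, rfl⟩
  obtain ⟨e, he⟩ : ∃ e : V ≃ₗ[F] W, ∀ x, Ψ (e x) = x := by
    refine ⟨((LinearEquiv.ofInjective Ψ hinj).trans (LinearEquiv.ofEq _ _ hrange)).symm,
      fun x => ?_⟩
    obtain ⟨w, rfl⟩ := ((LinearEquiv.ofInjective Ψ hinj).trans
      (LinearEquiv.ofEq _ _ hrange)).surjective x
    rw [LinearEquiv.symm_apply_apply]
    rfl
  refine ⟨e, fun x y z h => ?_, fun g x => ?_⟩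
  · have hw := hWmul _ (e x).2 _ (e y).2
    have : e z = ⟨_, hw⟩ := hinj (by rw [he, hmul _ _ ⟨_, hw⟩ rfl, he, he, h])
    rw [this]
  · rw [hmap]
    constructor
    · rintro ⟨w, hw, h⟩
      rw [← he] at h
      rw [← hinj h]
      exact hw
    · exact fun h => ⟨_, h, he x⟩

variable [AddCommGroup G]

/-- Restriction of a graded isomorphism to a subgroup of the grading group. -/
theorem GradedJordanIso.restrict {V : Submodule F A} {𝒥 : G → Submodule F A}
    {W : Submodule F B} {𝒦 : G → Submodule F B} (h : GradedJordanIso V 𝒥 W 𝒦)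
    (hV : ∀ g, 𝒥 g ≤ V) (hVmul : ∀ x ∈ V, ∀ y ∈ V, jordanMul F x y ∈ V)
    (hW : ∀ g, 𝒦 g ≤ W) (H : AddSubgroup G) {B' : Type*} [Ring B']
    [Algebra F B'] {W' : Submodule F B'} {𝒦' : H → Submodule F B'} (hW' : ⨆ g, 𝒦' g = W')
    (hWmul : ∀ x ∈ W', ∀ y ∈ W', jordanMul F x y ∈ W') (j : B' →ₗ[F] B)
    (hj : Function.Injective j) (hjmul : ∀ x y, j (x * y) = j x * j y)
    (hjK : ∀ (g : H) (b : B), b ∈ 𝒦 (g : G) ↔ ∃ x ∈ 𝒦' g, j x = b) :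
    GradedJordanIso (gradedPart 𝒥 H) (restrictGrading 𝒥 H) W' 𝒦' := by
  obtain ⟨e, he, heg⟩ := h
  have hjW : ∀ x ∈ W', j x ∈ W := by
    have : W' ≤ W.comap j := by
      rw [← hW', iSup_le_iff]
      exact fun g x hx => hW _ ((hjK g _).2 ⟨x, hx, rfl⟩)
    exact this
  have hle : ∀ g, 𝒦' g ≤ W' := fun g => hW' ▸ le_iSup 𝒦' g
  -- `e` is inverted so that `j` can be followed by a map into `A`.
  let Ψ : W' →ₗ[F] A := V.subtype ∘ₗ e.symm.toLinearMap ∘ₗ j.restrict hjW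
  have hΨ : ∀ x : W', Ψ x = (e.symm ⟨j x, hjW x x.2⟩ : V) := fun x => rfl
  refine GradedJordanIso.of_linearMap rfl hW' hWmul Ψ ?_ ?_ ?_
  · intro x y hxy
    rw [hΨ, hΨ] at hxy
    exact Subtype.ext (hj (congrArg Subtype.val (e.symm.injective (Subtype.ext hxy))))
  · intro x y z hz
    have h1 : j z = jordanMul F (j x) (j y) := by
      rw [hz, jordanMul, map_smul, map_add, hjmul, hjmul, jordanMul]
    obtain ⟨a, ha⟩ := e.surjective ⟨j x, hjW x x.2⟩
    obtain ⟨b, hb⟩ := e.surjective ⟨j y, hjW y y.2⟩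
    have hab := hVmul _ a.2 _ b.2
    have hc : e ⟨_, hab⟩ = ⟨j z, hjW z z.2⟩ := by
      apply Subtype.ext
      rw [he a b ⟨_, hab⟩ rfl, ha, hb]
      exact h1.symm
    rw [hΨ, hΨ, hΨ, ← ha, ← hb, ← hc]
    simp only [LinearEquiv.symm_apply_apply]
  · intro g a
    constructor
    · intro ha
      have h1 := (heg g ⟨a, hV g ha⟩).1 ha
      obtain ⟨x, hx, hxa⟩ := (hjK g _).1 h1
      refine ⟨⟨x, hle g hx⟩, hx, ?_⟩
      rw [hΨ]
      simp only [hxa, Subtype.coe_eta, LinearEquiv.symm_apply_apply]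
    · rintro ⟨x, hx, rfl⟩
      rw [hΨ]
      refine (heg g _).2 ?_
      rw [LinearEquiv.apply_symm_apply]
      exact (hjK g _).2 ⟨x, hx, rfl⟩

theorem AlgInvolution.jordanMul_mem (σ : AlgInvolution F A) {x y : A} (hx : x ∈ σ.H)
    (hy : y ∈ σ.H) : jordanMul F x y ∈ σ.H := by
  rw [AlgInvolution.mem_H] at *
  rw [jordanMul, map_smul, map_add, σ.map_mul, σ.map_mul, hx, hy, add_comm]

end GradedIso

/-! ### Twisted group algebras -/

namespace TwistedGroupAlgebra

variable {F K G : Type*} [Field F] [Field K] [Algebra F K] [AddCommGroup G] (lam : TwoCocycle G K)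

theorem single_zero (g : G) : single lam g 0 = 0 := Finsupp.single_zero g

theorem single_add (g : G) (c d : K) : single lam g (c + d) = single lam g c + single lam g d :=
  Finsupp.single_add g c d

theorem iSup_component : ⨆ g, component lam F g = ⊤ := by
  rw [eq_top_iff]
  rintro f -
  induction f using induction with
  | zero => exact Submodule.zero_mem _
  | add f g hf hg => exact Submodule.add_mem _ hf hg
  | single g c => exact le_iSup (component lam F) g ⟨c, rfl⟩

/-- A symmetric element is its own symmetric part, and `symmPart` preserves each component because
`σ` is graded. -/
theorem iSup_component_inf_H [CharZero F] (σ : AlgInvolution F (TwistedGroupAlgebra lam))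
    (hσ : ∀ g, ∀ x ∈ component lam F g, σ x ∈ component lam F g) :
    ⨆ g, component lam F g ⊓ σ.H = σ.H := by
  apply le_antisymm
  · exact iSup_le fun g => inf_le_right
  · intro f hf
    have h : (⊤ : Submodule F (TwistedGroupAlgebra lam)) ≤
        (⨆ g, component lam F g ⊓ σ.H).comap σ.symmPart := by
      rw [← iSup_component, iSup_le_iff]
      intro g x hx
      refine le_iSup (fun g => component lam F g ⊓ σ.H) g ⟨?_, σ.symmPart_mem x⟩
      exact Submodule.smul_mem _ _ (Submodule.add_mem _ hx (hσ g x hx))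
    rw [← σ.symmPart_of_symm hf]
    exact h trivial

theorem theta_single (q : QuadraticMap ℤ G (ZMod 2)) (hq : Compatible lam q) (g : G) (c : K) :
    theta lam q hq (single lam g c) = single lam g (c * sign K (q g)) := by
  change lift lam _ _ = _
  rw [lift_single, smul_single, smul_eq_mul]

theorem theta_component (q : QuadraticMap ℤ G (ZMod 2)) (hq : Compatible lam q) (g : G) :
    ∀ x ∈ component lam K g, theta lam q hq x ∈ component lam K g := by
  rintro _ ⟨c, rfl⟩
  exact ⟨_, (theta_single lam q hq g c).symm⟩

/-! #### Linear maps out of twisted group algebras -/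

section Eval

variable {A : Type*} [Ring A] [Algebra F A]

/-- The linear map `c x^g ↦ ι(c) x(g)`. -/
noncomputable def eval (ι : K →ₐ[F] A) (x : G → A) : TwistedGroupAlgebra lam →ₗ[F] A :=
  (Finsupp.lsum F (fun g => (LinearMap.mulRight F (x g)) ∘ₗ ι.toLinearMap) : (G →₀ K) →ₗ[F] A)

variable {lam} in
theorem eval_single (ι : K →ₐ[F] A) (x : G → A) (g : G) (c : K) :
    eval lam ι x (single lam g c) = ι c * x g := by
  refine (Finsupp.lsum_single _ _ _ _).trans ?_
  rfl

theorem eval_mul (ι : K →ₐ[F] A) (x : G → A) (hcomm : ∀ c g, ι c * x g = x g * ι c)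
    (hmul : ∀ a b, x a * x b = ι (lam a b) * x (a + b)) (f g : TwistedGroupAlgebra lam) :
    eval lam ι x (f * g) = eval lam ι x f * eval lam ι x g := by
  induction f using induction with
  | zero => rw [zero_mul, map_zero, zero_mul]
  | add f₁ f₂ h₁ h₂ => rw [add_mul, map_add, h₁, h₂, map_add, add_mul]
  | single a c =>
    induction g using induction with
    | zero => rw [mul_zero, map_zero, mul_zero]
    | add f₁ f₂ h₁ h₂ => rw [mul_add, map_add, h₁, h₂, map_add, mul_add]
    | single b d =>
      rw [single_mul_single, eval_single, eval_single, eval_single, mul_assoc (ι c),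
        ← mul_assoc (x a), ← hcomm, mul_assoc (ι d), hmul, map_mul, map_mul]
      simp only [mul_assoc]

theorem eval_smul (ι : K →ₐ[F] A) (x : G → A) (c : K) (f : TwistedGroupAlgebra lam) :
    eval lam ι x (c • f) = ι c * eval lam ι x f := by
  induction f using induction with
  | zero => rw [smul_zero, map_zero, mul_zero]
  | add f₁ f₂ h₁ h₂ => rw [smul_add, map_add, h₁, h₂, map_add, mul_add]
  | single a d => rw [smul_single, smul_eq_mul, eval_single, eval_single, map_mul, mul_assoc]

theorem eval_injective (ι : K →ₐ[F] A) (x : G → A)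
    (h : ∀ (s : Finset G) (c : G → K), ∑ g ∈ s, ι (c g) * x g = 0 → ∀ g ∈ s, c g = 0) :
    Function.Injective (eval lam ι x) := by
  rw [injective_iff_map_eq_zero]
  intro f hf
  have h1 : ∑ g ∈ Finsupp.support (M := K) f, ι ((show G →₀ K from f) g) * x g = 0 := hf
  have h2 := h _ _ h1
  refine Finsupp.ext (M := K) fun g => ?_
  by_contra hg
  exact hg (h2 g (Finsupp.mem_support_iff.2 hg))

end Eval

end TwistedGroupAlgebra

/-- Transport of an involution along a multiplicative linear bijection. -/
theorem AlgInvolution.exists_transport {F A B : Type*} [Field F] [Ring A] [Algebra F A] [Ring B]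
    [Algebra F B] (σ : AlgInvolution F A) (Ψ : B →ₗ[F] A) (hinj : Function.Injective Ψ)
    (hsurj : Function.Surjective Ψ) (hmul : ∀ x y, Ψ (x * y) = Ψ x * Ψ y) :
    ∃ ρ : AlgInvolution F B, ∀ x, Ψ (ρ x) = σ (Ψ x) := by
  let e : B ≃ₗ[F] A := LinearEquiv.ofBijective Ψ ⟨hinj, hsurj⟩
  have he : ∀ a, Ψ (e.symm a) = a := fun a => e.apply_symm_apply a
  have hρ : ∀ x, Ψ ((e.symm.toLinearMap ∘ₗ σ.toLinearMap ∘ₗ Ψ) x) = σ (Ψ x) := fun x => he _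
  refine ⟨⟨e.symm.toLinearMap ∘ₗ σ.toLinearMap ∘ₗ Ψ, fun a b => hinj ?_, fun a => hinj ?_⟩, hρ⟩
  · refine (hρ _).trans ?_
    rw [hmul, σ.map_mul]
    exact (congrArg₂ _ (hρ b) (hρ a)).symm.trans (hmul _ _).symm
  · exact (hρ _).trans ((congrArg _ (hρ a)).trans (σ.involutive _))

/-! ### Restriction to subgroups -/

/-- The restriction of a cocycle to a subgroup. -/
def TwoCocycle.restrict {G K : Type*} [AddCommGroup G] [CommRing K] (lam : TwoCocycle G K)
    (H : AddSubgroup G) : TwoCocycle H K :=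
  ⟨fun a b => lam a b, fun a b c => lam.cocycle a b c⟩

namespace TwistedGroupAlgebra

variable {F K G : Type*} [Field F] [Field K] [Algebra F K] [AddCommGroup G] (lam : TwoCocycle G K)
  (H : AddSubgroup G)

/-- The inclusion of the twisted group algebra of a subgroup. -/
noncomputable def inclusion (F : Type*) [Field F] [Algebra F K] :
    TwistedGroupAlgebra (lam.restrict H) →ₗ[F] TwistedGroupAlgebra lam :=
  (Finsupp.lmapDomain K F (Subtype.val : H → G) : (H →₀ K) →ₗ[F] (G →₀ K))

/-- The projection onto the twisted group algebra of a subgroup. -/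
noncomputable def retraction (F : Type*) [Field F] [Algebra F K] :
    TwistedGroupAlgebra lam →ₗ[F] TwistedGroupAlgebra (lam.restrict H) :=
  (Finsupp.lcomapDomain (Subtype.val : H → G) Subtype.val_injective : (G →₀ K) →ₗ[F] (H →₀ K))

theorem inclusion_single (h : H) (c : K) :
    inclusion lam H F (single _ h c) = single lam (h : G) c :=
  Finsupp.mapDomain_single

theorem inclusion_injective : Function.Injective (inclusion lam H F) :=
  Finsupp.mapDomain_injective Subtype.val_injective

theorem retraction_inclusion (x : TwistedGroupAlgebra (lam.restrict H)) :
    retraction lam H F (inclusion lam H F x) = x :=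
  Finsupp.comapDomain_mapDomain _ Subtype.val_injective x

theorem inclusion_mul (x y : TwistedGroupAlgebra (lam.restrict H)) :
    inclusion lam H F (x * y) = inclusion lam H F x * inclusion lam H F y := by
  induction x using induction with
  | zero => rw [zero_mul, map_zero, zero_mul]
  | add f₁ f₂ h₁ h₂ => rw [add_mul, map_add, h₁, h₂, map_add, add_mul]
  | single a c =>
    induction y using induction with
    | zero => rw [mul_zero, map_zero, mul_zero]
    | add f₁ f₂ h₁ h₂ => rw [mul_add, map_add, h₁, h₂, map_add, mul_add]
    | single b d =>
      rw [single_mul_single, inclusion_single, inclusion_single, inclusion_single,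
        single_mul_single]
      rfl

theorem inclusion_smul (c : K) (x : TwistedGroupAlgebra (lam.restrict H)) :
    inclusion lam H F (c • x) = c • inclusion lam H F x :=
  Finsupp.mapDomain_smul c x

theorem mem_component_iff_exists (h : H) (b : TwistedGroupAlgebra lam) :
    b ∈ component lam F (h : G) ↔
      ∃ x ∈ component (lam.restrict H) F h, inclusion lam H F x = b := by
  constructor
  · rintro ⟨c, rfl⟩
    exact ⟨single _ h c, ⟨c, rfl⟩, inclusion_single lam H h c⟩
  · rintro ⟨_, ⟨c, rfl⟩, rfl⟩
    exact ⟨c, (inclusion_single lam H h c).symm⟩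

theorem mem_component_inf_iff_exists {σ : AlgInvolution F (TwistedGroupAlgebra lam)}
    {ρ : AlgInvolution F (TwistedGroupAlgebra (lam.restrict H))}
    (hρ : ∀ x, inclusion lam H F (ρ x) = σ (inclusion lam H F x)) (h : H)
    (b : TwistedGroupAlgebra lam) :
    b ∈ component lam F (h : G) ⊓ σ.H ↔
      ∃ x ∈ component (lam.restrict H) F h ⊓ ρ.H, inclusion lam H F x = b := by
  rw [Submodule.mem_inf, mem_component_iff_exists]
  constructor
  · rintro ⟨⟨x, hx, rfl⟩, hb⟩
    exact ⟨x, ⟨hx, inclusion_injective lam H ((hρ x).trans hb)⟩, rfl⟩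
  · rintro ⟨x, ⟨hx, hx'⟩, rfl⟩
    exact ⟨⟨x, hx, rfl⟩, (hρ x).symm.trans (congrArg _ hx')⟩

/-- A graded involution restricts to the twisted group algebra of a subgroup. -/
theorem exists_restrict_involution (σ : AlgInvolution F (TwistedGroupAlgebra lam))
    (hσ : ∀ g, ∀ x ∈ component lam F g, σ x ∈ component lam F g) :
    ∃ ρ : AlgInvolution F (TwistedGroupAlgebra (lam.restrict H)),
      ∀ x, inclusion lam H F (ρ x) = σ (inclusion lam H F x) := by
  have hr : ∀ x, ∃ y, inclusion lam H F y = σ (inclusion lam H F x) := by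
    intro x
    induction x using induction with
    | zero => exact ⟨0, by rw [map_zero, map_zero]⟩
    | add f₁ f₂ h₁ h₂ =>
      obtain ⟨y₁, h₁⟩ := h₁
      obtain ⟨y₂, h₂⟩ := h₂
      exact ⟨y₁ + y₂, by rw [map_add, map_add, map_add, h₁, h₂]⟩
    | single a c =>
      obtain ⟨y, -, hy⟩ := (mem_component_iff_exists lam H a _).1
        (hσ a (inclusion lam H F (single _ a c)) ⟨c, (inclusion_single lam H a c).symm⟩)
      exact ⟨y, hy⟩
  -- By `hr`, `σ` maps the image of the inclusion into itself, and the retraction inverts the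
  -- inclusion there.
  let τ : TwistedGroupAlgebra (lam.restrict H) →ₗ[F] TwistedGroupAlgebra (lam.restrict H) :=
    retraction lam H F ∘ₗ σ.toLinearMap ∘ₗ inclusion lam H F
  have hτ : ∀ x, inclusion lam H F (τ x) = σ (inclusion lam H F x) := by
    intro x
    obtain ⟨y, hy⟩ := hr x
    change inclusion lam H F (retraction lam H F (σ (inclusion lam H F x))) = _
    rw [← hy, retraction_inclusion]
  refine ⟨⟨τ, fun a b => inclusion_injective (F := F) lam H ?_,
    fun a => inclusion_injective (F := F) lam H ?_⟩, hτ⟩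
  · change inclusion lam H F (τ (a * b)) = inclusion lam H F (τ b * τ a)
    rw [hτ, inclusion_mul, inclusion_mul, σ.map_mul, hτ, hτ]
  · change inclusion lam H F (τ (τ a)) = inclusion lam H F a
    rw [hτ, hτ, σ.involutive]

end TwistedGroupAlgebra

section RestrictTypes

open TwistedGroupAlgebra

variable {F : Type u} {A : Type v} [Field F] [Ring A] [Algebra F A]
variable {G : Type w} [AddCommGroup G] {V : Submodule F A} {𝒥 : G → Submodule F A}

theorem IsPlusType.restrict (h : IsPlusType V 𝒥) (hV : ∀ g, 𝒥 g ≤ V)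
    (hVmul : ∀ x ∈ V, ∀ y ∈ V, jordanMul F x y ∈ V) (H : AddSubgroup G) :
    IsPlusType (gradedPart 𝒥 H) (restrictGrading 𝒥 H) := by
  obtain ⟨lam, h⟩ := h
  exact ⟨lam.restrict H, h.restrict hV hVmul (fun g => le_top) H (iSup_component _)
    (fun _ _ _ _ => trivial) (inclusion lam H F) (inclusion_injective lam H) (inclusion_mul lam H)
    (mem_component_iff_exists lam H)⟩

variable [CharZero F]

theorem IsInvolutionType.restrict (h : IsInvolutionType V 𝒥) (hV : ∀ g, 𝒥 g ≤ V)
    (hVmul : ∀ x ∈ V, ∀ y ∈ V, jordanMul F x y ∈ V) (H : AddSubgroup G) :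
    IsInvolutionType (gradedPart 𝒥 H) (restrictGrading 𝒥 H) := by
  obtain ⟨lam, q, hq, h⟩ := h
  have hq' : Compatible (lam.restrict H) (q.comp H.subtype.toIntLinearMap) := fun a b => hq a b
  refine ⟨lam.restrict H, q.comp H.subtype.toIntLinearMap, hq', ?_⟩
  refine h.restrict hV hVmul (fun g => inf_le_right) H ?_ (fun x hx y hy => ?_)
    (inclusion lam H F) (inclusion_injective lam H) (inclusion_mul lam H) ?_
  · exact iSup_component_inf_H _ _ (theta_component _ _ _)
  · exact AlgInvolution.jordanMul_mem _ hx hy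
  · refine mem_component_inf_iff_exists lam H fun x => ?_
    induction x using induction with
    | zero => rw [map_zero, map_zero, map_zero]
    | add f₁ f₂ h₁ h₂ => rw [map_add, map_add, h₁, h₂, map_add, map_add]
    | single a c =>
      rw [theta_single, inclusion_single, inclusion_single, theta_single]
      rfl

theorem IsExtensionType.restrict (h : IsExtensionType V 𝒥) (hV : ∀ g, 𝒥 g ≤ V)
    (hVmul : ∀ x ∈ V, ∀ y ∈ V, jordanMul F x y ∈ V) (H : AddSubgroup G) :
    IsExtensionType (gradedPart 𝒥 H) (restrictGrading 𝒥 H) := by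
  obtain ⟨E, _, _, τ, lam, σ, hE, hτ, hσ, hgr, h⟩ := h
  obtain ⟨ρ, hρ⟩ := exists_restrict_involution lam H σ hgr
  have hρgr : ∀ g : H, ∀ x ∈ component (lam.restrict H) F g,
      ρ x ∈ component (lam.restrict H) F g := by
    intro g x hx
    have h1 := hgr g _ ((mem_component_iff_exists lam H g _).2 ⟨x, hx, rfl⟩)
    obtain ⟨y, hy, hxy⟩ := (mem_component_iff_exists lam H g _).1 h1
    rw [← hρ] at hxy
    rw [← inclusion_injective lam H hxy]
    exact hy
  refine ⟨E, inferInstance, inferInstance, τ, lam.restrict H, ρ, hE, hτ, ?_, hρgr, ?_⟩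
  · intro c x
    apply inclusion_injective (F := F) lam H
    rw [hρ, inclusion_smul, inclusion_smul, hσ, hρ]
  · exact h.restrict hV hVmul (fun g => inf_le_right) H (iSup_component_inf_H _ _ hρgr)
      (fun x hx y hy => ρ.jordanMul_mem hx hy) (inclusion lam H F) (inclusion_injective lam H)
      (inclusion_mul lam H) (mem_component_inf_iff_exists lam H hρ)

end RestrictTypes

/-! ### Direct unions -/

section DirectUnion

variable {F : Type u} {A : Type v} [Field F] [Ring A] [Algebra F A]
variable {G : Type w} [AddCommGroup G] {V : Submodule F A} {𝒥 : G → Submodule F A}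

variable [CharZero F]

/-- The part of a Jordan torus over a subgroup generated by elements of the support is a Jordan
torus. -/
theorem IsJordanTorus.restrict (hJ : IsJordanTorus V 𝒥) (s : Set G) (hs : ∀ g ∈ s, 𝒥 g ≠ ⊥) :
    IsJordanTorus (gradedPart 𝒥 (AddSubgroup.closure s))
      (restrictGrading 𝒥 (AddSubgroup.closure s)) where
  indep := hJ.indep.comp Subtype.val_injective
  iSup_eq := rfl
  one_mem := le_iSup (fun h : AddSubgroup.closure s => 𝒥 h) 0 hJ.one_mem_zero
  mul_mem g h := hJ.mul_mem g h
  closure_supp := by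
    rw [eq_top_iff]
    rintro ⟨g, hg⟩ -
    induction hg using AddSubgroup.closure_induction with
    | mem x hx => exact AddSubgroup.subset_closure (hs x hx)
    | zero => exact AddSubgroup.zero_mem _
    | add x y _ _ h₁ h₂ => exact AddSubgroup.add_mem _ h₁ h₂
    | neg x _ h => exact AddSubgroup.neg_mem _ h
  invertible g x hx hx0 := by
    obtain ⟨y, hy, h1, h2⟩ := hJ.exists_inv hx hx0
    refine ⟨y, le_iSup (fun h : AddSubgroup.closure s => 𝒥 h) (-g) hy, ?_, ?_⟩
    · rw [jordanMul_of_commute (h1.trans h2.symm), h1]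
    · have h3 : x * x * y = x := by rw [mul_assoc, h1, mul_one]
      have h4 : y * (x * x) = x := by rw [← mul_assoc, h2, one_mul]
      rw [jordanMul_self, jordanMul_of_commute (h3.trans h4.symm), h3]
  rank_le_one g := hJ.rank_le_one g

theorem IsJordanTorus.isDirectUnionOfTori [IsAddTorsionFree G] (hJ : IsJordanTorus V 𝒥)
    (T : ∀ H : AddSubgroup G, Submodule F A → (H → Submodule F A) → Prop)
    (hT : ∀ H, T H (gradedPart 𝒥 H) (restrictGrading 𝒥 H)) : IsDirectUnionOfTori V 𝒥 T := by
  classical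
  -- Finitely generated subgroups are free since `G` is torsion-free. Generators are taken from the
  -- support so that each subgroup is generated by its own support, even where the support is not
  -- all of `G`.
  refine ⟨{H | ∃ s : Finset G, (∀ g ∈ s, 𝒥 g ≠ ⊥) ∧ H = AddSubgroup.closure s},
    ⟨_, ∅, by simp, rfl⟩, ?_, ?_, ?_⟩
  · rintro _ ⟨s, hs, rfl⟩ _ ⟨t, ht, rfl⟩
    refine ⟨_, ⟨s ∪ t, fun g hg => (Finset.mem_union.1 hg).elim (hs g) (ht g), rfl⟩,
      AddSubgroup.closure_mono ?_, AddSubgroup.closure_mono ?_⟩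
    · exact Finset.coe_subset.2 Finset.subset_union_left
    · exact Finset.coe_subset.2 Finset.subset_union_right
  · rintro _ ⟨s, hs, rfl⟩
    have hfin : Module.Finite ℤ (AddSubgroup.closure (s : Set G)) :=
      Module.Finite.iff_addGroup_fg.2 (AddGroup.closure_finset_fg s)
    exact ⟨inferInstance, hfin, hJ.restrict _ hs, hT _⟩
  · ext x
    simp only [Set.mem_iUnion, SetLike.mem_coe, exists_prop]
    constructor
    · intro hx
      obtain ⟨f, hf, rfl⟩ := hJ.exists_sum hx
      refine ⟨_, ⟨f.support, fun g hg => ?_, rfl⟩, Submodule.sum_mem _ fun g hg => ?_⟩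
      · exact (Submodule.ne_bot_iff _).2 ⟨f g, hf g, Finsupp.mem_support_iff.1 hg⟩
      · exact le_iSup (fun h : AddSubgroup.closure (f.support : Set G) => 𝒥 h)
          ⟨g, AddSubgroup.subset_closure hg⟩ (hf g)
    · rintro ⟨H, -, hx⟩
      exact (iSup_le fun g : H => hJ.le g) hx

end DirectUnion

/-! ### Algebras with a central skew square root of a scalar -/

theorem sum_smul_eq_zero {F A G : Type*} [Field F] [AddCommGroup A] [Module F A]
    {𝒥 : G → Submodule F A} {x : G → A} (hJ : iSupIndep 𝒥) (hx : ∀ g, x g ∈ 𝒥 g)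
    (hx0 : ∀ g, x g ≠ 0) (s : Finset G) (c : G → F) (h : ∑ g ∈ s, c g • x g = 0) : ∀ g ∈ s, c g = 0 := by
  intro g hg
  have := (iSupIndep_iff_finsetSum_eq_zero_imp_eq_zero 𝒥).1 hJ s (fun g => c g • x g)
    (fun g _ => Submodule.smul_mem _ _ (hx g)) h g hg
  exact (smul_eq_zero.1 this).resolve_right (hx0 g)

section CentralSkewRoot

variable {F : Type u} {A : Type v} [Field F] [CharZero F] [Ring A] [Algebra F A]
variable {G : Type w} [AddCommGroup G]
  {𝒥 : G → Submodule F A} {σ : AlgInvolution F A} (hJ : IsJordanTorus σ.H 𝒥)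
  {ε : A} {d : F} (hs : σ ε = -ε) (hc : ∀ x, ε * x = x * ε) (hd : d ≠ 0)
  (hε : ε * ε = d • (1 : A))

include hJ hs hc hd hε

/-- The symmetric half of `xy` is `x ∘ y`. The commutator `k` is skew, so `εk` is symmetric; it is
homogeneous because its square `d k²` is. -/
theorem IsJordanTorus.exists_mul_eq_add [IsAddTorsionFree G] [Nontrivial A] {a b : G} {x y : A}
    (hx : x ∈ 𝒥 a) (hy : y ∈ 𝒥 b) :
    ∃ p ∈ 𝒥 (a + b), ∃ q ∈ 𝒥 (a + b), x * y = p + ε * q := by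
  have hp := hJ.mul_mem a b x hx y hy
  obtain ⟨k, hk⟩ : ∃ k, k = x * y - y * x := ⟨_, rfl⟩
  have hks : σ k = -k := by
    rw [hk, map_sub, σ.map_mul, σ.map_mul, hJ.symm hx, hJ.symm hy, neg_sub]
  have hεk : ε * k ∈ 𝒥 (a + b) := by
    apply hJ.mem_of_mul_self_mem
    · rw [AlgInvolution.mem_H, σ.map_mul, hs, hks, neg_mul_neg, hc]
    · have h1 : ε * k * (ε * k) = d • (k * k) := by
        rw [mul_assoc, ← mul_assoc k, ← hc k, mul_assoc, ← mul_assoc ε, hε, smul_mul_assoc, one_mul]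
      -- This expresses `k²` through squares and the operators `x _ x`, which preserve the grading
      -- of `J`.
      have h2 : k * k = (x * y + y * x) * (x * y + y * x)
          - (2 : F) • (x * (y * y) * x + y * (x * x) * y) := by
        rw [hk, two_smul]
        noncomm_ring
      have e1 : a + (a + (b + b)) = a + b + (a + b) := by abel
      have e2 : b + (b + (a + a)) = a + b + (a + b) := by abel
      rw [h1, h2, ← two_smul_jordanMul (F := F), smul_mul_smul_comm]
      refine Submodule.smul_mem _ _ (Submodule.sub_mem _ (Submodule.smul_mem _ _
        (hJ.mul_self_mem hp)) (Submodule.smul_mem _ _ (Submodule.add_mem _ ?_ ?_)))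
      · rw [← e1]
        exact hJ.mul_mul_mem hx (hJ.mul_self_mem hy)
      · rw [← e2]
        exact hJ.mul_mul_mem hy (hJ.mul_self_mem hx)
  -- As `ε(εk) = dk`, the factor `1/(2d)` recovers `k/2`.
  refine ⟨_, hp, (2⁻¹ * d⁻¹ : F) • (ε * k), Submodule.smul_mem _ _ hεk, ?_⟩
  rw [mul_smul_comm, ← mul_assoc, hε, smul_mul_assoc, one_mul, smul_smul, inv_mul_cancel_right₀ hd,
    jordanMul, ← smul_add, hk]
  apply smul_right_injective A (two_ne_zero (α := F))
  simp only
  rw [smul_smul, mul_inv_cancel₀ two_ne_zero, one_smul, two_smul]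
  abel

/-- The support is closed under addition: `xy = p + εq` is invertible, so `p` and `q` cannot both
vanish. -/
theorem IsJordanTorus.supp_eq_top [IsAddTorsionFree G] [Nontrivial A] (g : G) : 𝒥 g ≠ ⊥ := by
  have hg : g ∈ AddSubgroup.closure {g : G | 𝒥 g ≠ ⊥} := hJ.closure_supp ▸ AddSubgroup.mem_top g
  induction hg using AddSubgroup.closure_induction with
  | mem x hx => exact hx
  | zero => exact (Submodule.ne_bot_iff _).2 ⟨1, hJ.one_mem_zero, one_ne_zero⟩
  | add a b _ _ h₁ h₂ =>
    obtain ⟨x, hx, hx0⟩ := (Submodule.ne_bot_iff _).1 h₁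
    obtain ⟨y, hy, hy0⟩ := (Submodule.ne_bot_iff _).1 h₂
    obtain ⟨p, hp, q, hq, h⟩ := hJ.exists_mul_eq_add hs hc hd hε hx hy
    intro hbot
    rw [hbot, Submodule.mem_bot] at hp hq
    rw [hp, hq, mul_zero, add_zero] at h
    exact ((IsMonomial.of_mem hx hx0).mul_mono (IsMonomial.of_mem hy hy0)).ne_zero hJ h
  | neg a _ h => exact hJ.exists_mem_ne_zero_neg h

/-- A homogeneous basis, with structure constants. -/
theorem IsJordanTorus.exists_basis [IsAddTorsionFree G] [Nontrivial A] :
    ∃ (x : G → A) (α β : G → G → F), (∀ g, x g ∈ 𝒥 g) ∧ (∀ g, x g ≠ 0) ∧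
      (∀ a b, x a * x b = α a b • x (a + b) + β a b • (ε * x (a + b))) ∧
      (∀ a b, x b * x a = α a b • x (a + b) - β a b • (ε * x (a + b))) := by
  have h0 : ∀ g, ∃ x ∈ 𝒥 g, x ≠ 0 := fun g =>
    (Submodule.ne_bot_iff _).1 (hJ.supp_eq_top hs hc hd hε g)
  choose x hx hx0 using h0
  have h1 : ∀ a b, ∃ α β : F, x a * x b = α • x (a + b) + β • (ε * x (a + b)) := by
    intro a b
    obtain ⟨p, hp, q, hq, h⟩ := hJ.exists_mul_eq_add hs hc hd hε (hx a) (hx b)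
    obtain ⟨α, rfl⟩ := hJ.exists_smul (hx _) (hx0 _) hp
    obtain ⟨β, rfl⟩ := hJ.exists_smul (hx _) (hx0 _) hq
    exact ⟨α, β, by rw [h, mul_smul_comm]⟩
  choose α β hαβ using h1
  refine ⟨x, α, β, hx, hx0, hαβ, fun a b => ?_⟩
  -- The reversed product is the image under `σ`, which changes the sign of `ε`.
  have := congrArg σ.toLinearMap (hαβ a b)
  rw [σ.map_mul, map_add, map_smul, map_smul, σ.map_mul, hs, hJ.symm (hx _), hJ.symm (hx _),
    hJ.symm (hx _), mul_neg, smul_neg, ← sub_eq_add_neg, ← hc] at this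
  exact this

/-- `symmPart` separates `J` from the skew space `εJ`, and multiplication by `ε` brings the skew
half back to `J`. -/
theorem sum_smul_add_eq_zero {x : G → A} (hx : ∀ g, x g ∈ 𝒥 g) (hx0 : ∀ g, x g ≠ 0)
    (s : Finset G) (c e : G → F) (h : ∑ g ∈ s, (c g • x g + e g • (ε * x g)) = 0) :
    ∀ g ∈ s, c g = 0 ∧ e g = 0 := by
  have hskew : ∀ g, σ (ε * x g) = -(ε * x g) := fun g => by
    rw [σ.map_mul, hs, hJ.symm (hx g), mul_neg, hc]
  have h1 : ∑ g ∈ s, c g • x g = 0 := by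
    have := congrArg σ.symmPart h
    rw [map_sum, map_zero] at this
    rw [← this]
    refine Finset.sum_congr rfl fun g _ => ?_
    rw [map_add, map_smul, map_smul, σ.symmPart_of_symm (hJ.symm (hx g)),
      σ.symmPart_of_skew (hskew g), smul_zero, add_zero]
  have h2 : ∑ g ∈ s, e g • x g = 0 := by
    rw [Finset.sum_add_distrib, h1, zero_add] at h
    have := congrArg (fun z => ε * z) h
    simp only [mul_zero, Finset.mul_sum, mul_smul_comm, ← mul_assoc, hε, smul_mul_assoc,
      one_mul] at this
    simp only [smul_comm _ d] at this
    rw [← Finset.smul_sum] at this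
    exact (smul_eq_zero.1 this).resolve_left hd
  exact fun g hg => ⟨sum_smul_eq_zero hJ.indep hx hx0 s c h1 g hg,
    sum_smul_eq_zero hJ.indep hx hx0 s e h2 g hg⟩

open TwistedGroupAlgebra

/-- If the scalar is a square, the Jordan torus has plus type. -/
theorem IsJordanTorus.isPlusType [IsAddTorsionFree G] [Nontrivial A] {r : F} (hr : r * r = d) :
    IsPlusType σ.H 𝒥 := by
  obtain ⟨x, α, β, hx, hx0, hαβ, hβα⟩ := hJ.exists_basis hs hc hd hε
  have hr0 : r ≠ 0 := fun h => hd (by rw [← hr, h, zero_mul])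
  -- On the ideal `eA` the element `ε` acts as the scalar `r`, so `α + βε` becomes `α + βr` there;
  -- associativity in `eA` yields the cocycle identity.
  obtain ⟨e, he⟩ : ∃ e, e = r • (1 : A) + ε := ⟨_, rfl⟩
  have hec : ∀ y, e * y = y * e := fun y => by
    rw [he, add_mul, mul_add, hc, smul_mul_assoc, mul_smul_comm, one_mul, mul_one]
  have heε : e * ε = r • e := by
    rw [he, add_mul, hε, smul_mul_assoc, one_mul, smul_add, smul_smul, hr, add_comm]
  have he0 : e ≠ 0 := by
    intro h
    rw [he] at h
    have h1 : r • (1 : A) - ε = 0 := by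
      have := congrArg σ.toLinearMap h
      rwa [map_add, map_smul, σ.map_one, hs, map_zero, ← sub_eq_add_neg] at this
    have h2 : (r + r) • (1 : A) = 0 := by
      have h3 : (r + r) • (1 : A) = (r • (1 : A) + ε) + (r • (1 : A) - ε) := by module
      rw [h3, h, h1, add_zero]
    rcases smul_eq_zero.1 h2 with h3 | h3
    · exact hr0 (by rw [← two_mul] at h3; exact (mul_eq_zero.1 h3).resolve_left two_ne_zero)
    · exact one_ne_zero h3
  have hm : ∀ {g y}, IsMonomial 𝒥 g y → e * y ≠ 0 := by
    intro g y hy h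
    obtain ⟨y', -, h1, -⟩ := hy.exists_inv hJ
    exact he0 (by rw [← mul_one e, ← h1, ← mul_assoc, h, zero_mul])
  have hxm : ∀ g, IsMonomial 𝒥 g (x g) := fun g => IsMonomial.of_mem (hx g) (hx0 g)
  have hmul : ∀ a b, e * (x a * x b) = (α a b + β a b * r) • (e * x (a + b)) := by
    intro a b
    rw [hαβ, mul_add, mul_smul_comm, mul_smul_comm, ← mul_assoc, heε, smul_mul_assoc, add_smul,
      smul_smul]
  -- Hence `λ(a, b) + λ(b, a) = 2 α(a, b)`, the structure constant of the symmetrized product in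
  -- `A`.
  have hmul' : ∀ a b, α b a + β b a * r = α a b - β a b * r := by
    intro a b
    apply IsMonomial.smul_left_cancel_of_ne_zero (hm (hxm (a + b)))
    have := hmul b a
    rw [add_comm b a] at this
    rw [← this, hβα, mul_sub, mul_smul_comm, mul_smul_comm, ← mul_assoc, heε, smul_mul_assoc,
      sub_smul, smul_smul]
  have hne : ∀ a b, α a b + β a b * r ≠ 0 := by
    intro a b h
    apply hm ((hxm a).mul_mono (hxm b))
    rw [hmul, h, zero_smul]
  let lam : TwoCocycle G F := ⟨fun a b => Units.mk0 _ (hne a b), by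
    intro a b c
    apply Units.ext
    simp only [Units.val_mul, Units.val_mk0]
    apply IsMonomial.smul_left_cancel_of_ne_zero (hm (hxm (a + b + c)))
    have h1 : e * (x a * x b * x c) =
        ((α (a + b) c + β (a + b) c * r) * (α a b + β a b * r)) • (e * x (a + b + c)) := by
      rw [← mul_assoc, hmul, smul_mul_assoc, mul_assoc, hmul, smul_smul, mul_comm (α a b + _)]
    rw [← h1, mul_assoc, hec, mul_assoc, ← hec, hmul b c, mul_smul_comm, ← mul_assoc, ← hec,
      mul_assoc, hmul, smul_smul, add_assoc, mul_comm (α b c + _)]⟩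
  have hlam : ∀ a b, (lam a b : F) = α a b + β a b * r := fun a b => rfl
  refine ⟨lam, ?_⟩
  let Ψ := eval lam (Algebra.ofId F A) x
  have hΨ : ∀ g c, Ψ (single lam g c) = c • x g := fun g c => by
    rw [Algebra.smul_def]
    exact eval_single _ _ _ _
  -- Only Jordan products are claimed to be preserved: associative products in `A` may involve `ε`.
  have hΨmul : ∀ f g, Ψ (jordanMul F f g) = jordanMul F (Ψ f) (Ψ g) := by
    intro f g
    simp only [← jordanMulHom_apply]
    induction f using induction with
    | zero => simp only [map_zero, LinearMap.zero_apply]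
    | add f₁ f₂ h₁ h₂ => simp only [map_add, LinearMap.add_apply, h₁, h₂]
    | single a c =>
      induction g using induction with
      | zero => simp only [map_zero]
      | add f₁ f₂ h₁ h₂ => simp only [map_add, h₁, h₂]
      | single b c' =>
        rw [jordanMulHom_apply, jordanMulHom_apply]
        simp only [jordanMul, single_mul_single, map_smul, map_add, hΨ, hlam, smul_mul_smul_comm]
        rw [hmul' a b, hαβ, hβα, add_comm b a]
        module
  refine GradedJordanIso.of_linearMap hJ.iSup_eq (iSup_component lam) (fun _ _ _ _ => trivial)
    (Ψ ∘ₗ (⊤ : Submodule F (TwistedGroupAlgebra lam)).subtype) ?_ ?_ ?_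
  · refine Function.Injective.comp (g := Ψ) ?_ (Submodule.subtype_injective _)
    apply eval_injective
    intro s c h
    apply sum_smul_eq_zero hJ.indep hx hx0 s c
    rw [← h]
    exact Finset.sum_congr rfl fun g _ => Algebra.smul_def _ _
  · intro x y z h
    change Ψ z = jordanMul F (Ψ x) (Ψ y)
    rw [h, hΨmul]
  · intro g a
    constructor
    · intro ha
      obtain ⟨c, rfl⟩ := hJ.exists_smul (hx g) (hx0 g) ha
      exact ⟨⟨single lam g c, trivial⟩, ⟨c, rfl⟩, hΨ g c⟩
    · rintro ⟨⟨_, -⟩, ⟨c, rfl⟩, rfl⟩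
      exact (hΨ g c).symm ▸ Submodule.smul_mem _ _ (hx g)

/-- If the scalar is not a square, the Jordan torus has extension type. -/
theorem IsJordanTorus.isExtensionType [IsAddTorsionFree G] [Nontrivial A] (hr : ∀ r, r * r ≠ d) :
    IsExtensionType σ.H 𝒥 := by
  obtain ⟨x, α, β, hx, hx0, hαβ, -⟩ := hJ.exists_basis hs hc hd hε
  -- This makes `F[ω]` with `ω² = d` a field; `ι` below sends `ω` to `ε`, and `τ` is `ω ↦ -ω`.
  have : Fact (∀ r : F, r ^ 2 ≠ d + 0 * r) := ⟨fun r => by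
    rw [zero_mul, add_zero, pow_two]
    exact hr r⟩
  let E := QuadraticAlgebra F d 0
  let τ : E ≃ₐ[F] E := AlgEquiv.ofBijective
    ({ starRingEnd E with
        commutes' := fun r => by
          change Star.star (algebraMap F E r) = _
          ext <;> simp [E] } : E →ₐ[F] E) (star_involutive (R := E)).bijective
  have hτ : ∀ c e : F, τ (⟨c, e⟩ : E) = ⟨c, -e⟩ := by
    intro c e
    change Star.star (⟨c, e⟩ : E) = _
    ext <;> simp
  let ι : E →ₐ[F] A := QuadraticAlgebra.lift ⟨ε, by rw [hε, zero_smul, add_zero]⟩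
  have hι : ∀ c e : F, ι ⟨c, e⟩ = c • (1 : A) + e • ε := by
    intro c e
    rfl
  have hισ : ∀ c, σ (ι c) = ι (τ c) := by
    rintro ⟨c, e⟩
    rw [hτ, hι, hι, map_add, map_smul, map_smul, σ.map_one, hs, smul_neg, neg_smul]
  have hιc : ∀ c y, ι c * y = y * ι c := by
    rintro ⟨c, e⟩ y
    rw [hι, add_mul, mul_add, smul_mul_assoc, smul_mul_assoc, mul_smul_comm, mul_smul_comm, one_mul,
      mul_one, hc]
  have hιx : ∀ (c e : F) g, ι ⟨c, e⟩ * x g = c • x g + e • (ε * x g) := by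
    intro c e g
    rw [hι, add_mul, smul_mul_assoc, smul_mul_assoc, one_mul]
  have hindep : ∀ (s : Finset G) (c : G → E), ∑ g ∈ s, ι (c g) * x g = 0 → ∀ g ∈ s, c g = 0 := by
    intro s c h g hg
    have h1 := sum_smul_add_eq_zero hJ hs hc hd hε hx hx0 s (fun g => (c g).re) (fun g => (c g).im)
      (by rw [← h]; exact Finset.sum_congr rfl fun g _ => (hιx _ _ g).symm) g hg
    exact QuadraticAlgebra.ext h1.1 h1.2
  have hcancel : ∀ g (c e : E), ι c * x g = ι e * x g → c = e := by
    intro g c e h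
    have := hindep {g} (fun _ => c - e)
      (by rw [Finset.sum_singleton, map_sub, sub_mul, h, sub_self]) g (Finset.mem_singleton_self g)
    exact sub_eq_zero.1 this
  have hne : ∀ a b, (⟨α a b, β a b⟩ : E) ≠ 0 := by
    intro a b h
    refine ((IsMonomial.of_mem (hx a) (hx0 a)).mul_mono
      (IsMonomial.of_mem (hx b) (hx0 b))).ne_zero hJ ?_
    rw [hαβ, ← hιx, h, map_zero, zero_mul]
  have hmul : ∀ a b, x a * x b = ι ⟨α a b, β a b⟩ * x (a + b) := fun a b => by rw [hαβ, hιx]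
  let lam : TwoCocycle G E := ⟨fun a b => Units.mk0 _ (hne a b), by
    intro a b c
    apply Units.ext
    simp only [Units.val_mul, Units.val_mk0]
    apply hcancel (a + b + c)
    have h1 : x a * x b * x c =
        ι (⟨α (a + b) c, β (a + b) c⟩ * ⟨α a b, β a b⟩) * x (a + b + c) := by
      rw [hmul, mul_assoc, hmul, ← mul_assoc, map_mul, hιc]
    rw [← h1, mul_assoc, hmul b c, ← mul_assoc, ← hιc, mul_assoc, hmul, ← mul_assoc, ← map_mul,
      mul_comm (⟨α b c, _⟩ : E), add_assoc]⟩
  have hlam : ∀ a b, (lam a b : E) = ⟨α a b, β a b⟩ := fun a b => rfl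
  obtain ⟨Ψ, hΨ⟩ : ∃ Ψ, Ψ = eval lam ι x := ⟨_, rfl⟩
  have hΨs : ∀ g c, Ψ (single lam g c) = ι c * x g := fun g c => by rw [hΨ, eval_single]
  have hΨsmul : ∀ c f, Ψ (c • f) = ι c * Ψ f := fun c f => by rw [hΨ, eval_smul]
  have hΨmul : ∀ f g, Ψ (f * g) = Ψ f * Ψ g := by
    rw [hΨ]
    exact eval_mul lam ι x (fun c g => hιc c _) fun a b => by rw [hlam, hmul]
  have hinj : Function.Injective Ψ := by
    rw [hΨ]
    exact eval_injective lam ι x hindep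
  have hHrange : ∀ y, σ y = y → ∃ f, Ψ f = y := by
    have : σ.H ≤ LinearMap.range Ψ := by
      rw [← hJ.iSup_eq, iSup_le_iff]
      intro g y hy
      obtain ⟨c, rfl⟩ := hJ.exists_smul (hx g) (hx0 g) hy
      exact ⟨single lam g ⟨c, 0⟩, by rw [hΨs, hιx, zero_smul, add_zero]⟩
    exact this
  -- `A = J ⊕ εJ`: `ε` makes a skew element symmetric, and `d⁻¹ε` is the inverse of `ε`.
  have hsurj : Function.Surjective Ψ := by
    intro y
    obtain ⟨f₁, h₁⟩ := hHrange (σ.symmPart y) (σ.symmPart_mem y)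
    obtain ⟨f₂, h₂⟩ := hHrange (ε * (y - σ.symmPart y)) (by
      have : σ (y - σ.symmPart y) = -(y - σ.symmPart y) := by
        rw [map_sub, σ.symmPart_mem y, σ.symmPart_apply]
        apply smul_right_injective A (two_ne_zero (α := F))
        simp only [smul_sub, smul_neg, smul_add, smul_smul, mul_inv_cancel₀ (two_ne_zero (α := F)),
          one_smul]
        module
      rw [σ.map_mul, this, hs, neg_mul_neg, hc])
    refine ⟨f₁ + (⟨0, d⁻¹⟩ : E) • f₂, ?_⟩
    rw [map_add, hΨsmul, h₁, h₂, hι, zero_smul, zero_add, smul_mul_assoc, ← mul_assoc, hε,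
      smul_mul_assoc, one_mul, smul_smul, inv_mul_cancel₀ hd, one_smul, add_sub_cancel]
  obtain ⟨ρ, hρ⟩ := σ.exists_transport Ψ hinj hsurj hΨmul
  have hρgr : ∀ g, ∀ f ∈ component lam F g, ρ f ∈ component lam F g := by
    rintro g _ ⟨c, rfl⟩
    refine ⟨τ c, hinj ?_⟩
    rw [hρ]
    change Ψ (single lam g (τ c)) = σ (Ψ (single lam g c))
    rw [hΨs, hΨs, σ.map_mul, hJ.symm (hx g), hισ, hιc]
  refine ⟨E, inferInstance, inferInstance, τ, lam, ρ, QuadraticAlgebra.finrank_eq_two d 0,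
    ⟨⟨0, 1⟩, ?_⟩, ?_, hρgr, ?_⟩
  · intro h
    rw [hτ] at h
    have h1 : -(1 : F) = 1 := congrArg QuadraticAlgebra.im h
    exact two_ne_zero (α := F) (by linear_combination -h1)
  · intro c f
    apply hinj
    rw [hρ, hΨsmul, hΨsmul, hρ, σ.map_mul, hισ, hιc]
  refine GradedJordanIso.of_linearMap hJ.iSup_eq (iSup_component_inf_H lam ρ hρgr)
    (fun _ hx _ hy => ρ.jordanMul_mem hx hy) (Ψ ∘ₗ ρ.H.subtype) ?_ ?_ ?_
  · exact Function.Injective.comp (g := Ψ) hinj (Submodule.subtype_injective _)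
  · intro y z w h
    change Ψ w = jordanMul F (Ψ y) (Ψ z)
    rw [h, jordanMul, map_smul, map_add, hΨmul, hΨmul, jordanMul]
  · intro g a
    constructor
    · intro ha
      obtain ⟨c, rfl⟩ := hJ.exists_smul (hx g) (hx0 g) ha
      have h1 : Ψ (single lam g ⟨c, 0⟩) = c • x g := by rw [hΨs, hιx, zero_smul, add_zero]
      have h2 : ρ (single lam g ⟨c, 0⟩) = single lam g ⟨c, 0⟩ :=
        hinj (by rw [hρ, h1, hJ.symm ha])
      exact ⟨⟨_, h2⟩, ⟨⟨_, rfl⟩, h2⟩, h1⟩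
    · rintro ⟨⟨_, h⟩, ⟨⟨⟨c, e⟩, rfl⟩, -⟩, rfl⟩
      change Ψ (single lam g ⟨c, e⟩) ∈ 𝒥 g
      have h1 : σ (Ψ (single lam g ⟨c, e⟩)) = Ψ (single lam g ⟨c, e⟩) := by
        rw [← hρ]
        exact congrArg Ψ h
      rw [hΨs, σ.map_mul, hJ.symm (hx g), hισ, ← hιc] at h1
      -- The coefficient of a symmetric homogeneous element is fixed by `τ`, so its `ω`-part
      -- vanishes.
      have h2 := hcancel g _ _ h1
      rw [hτ] at h2
      have h3 : -e = e := congrArg QuadraticAlgebra.im h2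
      have h4 : e = 0 := by
        have : (2 : F) * e = 0 := by linear_combination -h3
        exact (mul_eq_zero.1 this).resolve_left two_ne_zero
      rw [hΨs, hιx, h4, zero_smul, add_zero]
      exact Submodule.smul_mem _ _ (hx g)

end CentralSkewRoot

/-! ### Quadratic maps with values in the field with two elements -/

/-- A map to `𝔽₂` with additive and alternating polarization is quadratic. -/
theorem exists_quadraticMap_zmod_two {G : Type*} [AddCommGroup G] (q : G → ZMod 2)
    (hadd : ∀ a a' b, QuadraticMap.polar q (a + a') b
      = QuadraticMap.polar q a b + QuadraticMap.polar q a' b)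
    (halt : ∀ a, QuadraticMap.polar q a a = 0) :
    ∃ Q : QuadraticMap ℤ G (ZMod 2), ∀ g, Q g = q g := by
  have hsmul : ∀ (n : ℤ) (a b : G), QuadraticMap.polar q (n • a) b = n • QuadraticMap.polar q a b :=
    fun n a b => map_zsmul (AddMonoidHom.mk' (fun a => QuadraticMap.polar q a b)
      fun a a' => hadd a a' b) n a
  -- The polarization of `n • a` with `a` is `n` times that of `a` with itself, which is zero.
  have hz : ∀ (n : ℤ) (a : G), q (n • a + a) = q (n • a) + q a := by
    intro n a
    have h := hsmul n a a
    rw [halt, smul_zero, QuadraticMap.polar, sub_sub] at h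
    exact sub_eq_zero.1 h
  have h0 : q 0 = 0 := by
    have h := hz 0 0
    rw [smul_zero, add_zero] at h
    exact left_eq_add.1 h
  have hn : ∀ (n : ℤ) (a : G), q (n • a) = n • q a := by
    intro n a
    induction n using Int.induction_on with
    | zero => rw [zero_smul, zero_smul, h0]
    | succ n ih => rw [add_smul, one_smul, hz, ih, add_smul, one_smul]
    | pred n ih =>
      have h := hz (-(n : ℤ) - 1) a
      have e : (-(n : ℤ) - 1) • a + a = (-(n : ℤ)) • a := by rw [sub_smul, one_smul, sub_add_cancel]
      rw [e, ih] at h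
      rw [sub_smul (-(n : ℤ)) 1 (q a), one_smul, h, add_sub_cancel_right]
  refine ⟨QuadraticMap.ofPolar q (fun n a => ?_) hadd hsmul, fun g => rfl⟩
  -- Linear scaling along multiples is also quadratic scaling, since `m² = m` in `𝔽₂`.
  rw [hn, zsmul_eq_mul, zsmul_eq_mul, Int.cast_mul]
  generalize (n : ZMod 2) = m
  generalize q a = z
  revert m z
  decide

namespace TwistedGroupAlgebra

theorem sign_zero (K : Type*) [CommRing K] : sign K 0 = 1 := pow_zero _

theorem sign_one (K : Type*) [CommRing K] : sign K 1 = -1 := pow_one _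

theorem sign_injective (K : Type*) [Field K] [CharZero K] : Function.Injective (sign K) := by
  have h : ∀ z : ZMod 2, z = 0 ∨ z = 1 := by decide
  have hne : (1 : K) ≠ -1 := fun h => two_ne_zero (α := K) (by linear_combination h)
  intro z t hzt
  rcases h z with rfl | rfl <;> rcases h t with rfl | rfl
  · rfl
  · rw [sign_zero, sign_one] at hzt
    exact absurd hzt hne
  · rw [sign_zero, sign_one] at hzt
    exact absurd hzt.symm hne
  · rfl

end TwistedGroupAlgebra

/-! ### Involution type -/

section InvolutionType

variable {F : Type u} {A : Type v} [Field F] [CharZero F] [Ring A] [Algebra F A]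
variable {G : Type w} [AddCommGroup G] [IsAddTorsionFree G]
  {𝒥 : G → Submodule F A} {σ : AlgInvolution F A} (hJ : IsJordanTorus σ.H 𝒥)
  (hprime : σ.IsPrime) (hgen : Algebra.adjoin F (σ.H : Set A) = ⊤)
  (hII : ¬ σ.HasCentralSkewRoot)

include hJ hprime hgen hII

/-- Applying `σ` to `xy = c yx` gives `yx = c xy`, so `c² = 1`. -/
theorem IsJordanTorus.commute_or_anticommute {a b : G} {x y : A} (hx : x ∈ 𝒥 a) (hx0 : x ≠ 0)
    (hy : y ∈ 𝒥 b) (hy0 : y ≠ 0) : x * y = y * x ∨ x * y = -(y * x) := by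
  have := hprime.1
  obtain ⟨c, hc⟩ := hJ.exists_commute_smul hprime hgen hII hx hx0 hy hy0
  have h1 : y * x = c • (x * y) := by
    have := congrArg σ.toLinearMap hc
    rwa [map_smul, σ.map_mul, σ.map_mul, hJ.symm hx, hJ.symm hy] at this
  have h2 : c * c = 1 := by
    apply IsMonomial.smul_left_cancel_of_ne_zero
      (((IsMonomial.of_mem hx hx0).mul_mono (IsMonomial.of_mem hy hy0)).ne_zero hJ)
    rw [mul_smul, ← h1, ← hc, one_smul]
  rcases mul_self_eq_one_iff.1 h2 with rfl | rfl
  · left; rw [hc, one_smul]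
  · right; rw [hc, neg_one_smul]

theorem IsMonomial.commute_or_anticommute {a g : G} {x p : A} (hp : IsMonomial 𝒥 g p)
    (hx : x ∈ 𝒥 a) (hx0 : x ≠ 0) : p * x = x * p ∨ p * x = -(x * p) := by
  induction hp with
  | one => left; rw [one_mul, mul_one]
  | @mul b g y p hy hy0 _ ih =>
    rcases ih with h | h <;>
      rcases hJ.commute_or_anticommute hprime hgen hII hy hy0 hx hx0 with h' | h'
    · left; rw [mul_assoc, h, ← mul_assoc, h', mul_assoc]
    · right; rw [mul_assoc, h, ← mul_assoc, h', neg_mul, mul_assoc]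
    · right; rw [mul_assoc, h, mul_neg, ← mul_assoc, h', mul_assoc]
    · left; rw [mul_assoc, h, mul_neg, ← mul_assoc, h', neg_mul, neg_neg, mul_assoc]

/-- `σ` reverses the factors, and each interchange of factors costs at most a sign. -/
theorem IsMonomial.symm_or_skew {g : G} {p : A} (hp : IsMonomial 𝒥 g p) :
    σ p = p ∨ σ p = -p := by
  induction hp with
  | one => left; exact σ.map_one
  | @mul b g y p hy hy0 hp ih =>
    rw [σ.map_mul, hJ.symm hy]
    rcases ih with h | h <;>
      rcases hp.commute_or_anticommute hJ hprime hgen hII hy hy0 with h' | h' <;> rw [h]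
    · left; exact h'
    · right; exact h'
    · right; rw [neg_mul, h']
    · left; rw [neg_mul, h', neg_neg]

/-- A nonscalar skew monomial of degree zero would be central with square minus its norm, which
`hII` forbids. -/
theorem IsMonomial.scalar_of_zero {p : A} (hp : IsMonomial 𝒥 0 p) : ∃ c : F, p = c • (1 : A) := by
  have := hprime.1
  rcases hp.symm_or_skew hJ hprime hgen hII with h | h
  · exact hp.exists_smul_of_zero_symm hJ h
  · refine (hp.scalar_or_central hJ h).resolve_right fun hc => hII ?_
    obtain ⟨n, hn0, hn, -⟩ := hp.exists_norm hJ
    refine ⟨p, -n, h, hJ.central_of_commute hgen hc, neg_ne_zero.2 hn0, ?_⟩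
    rw [neg_smul, ← hn, h, mul_neg, neg_neg]

/-- The quotient `p q⁻¹` is a monomial of degree zero. -/
theorem IsMonomial.exists_smul {g : G} {p q : A} (hp : IsMonomial 𝒥 g p) (hq : IsMonomial 𝒥 g q) :
    ∃ c : F, c ≠ 0 ∧ p = c • q := by
  have := hprime.1
  obtain ⟨q', hq', -, h2⟩ := hq.exists_inv hJ
  have h := hp.mul_mono hq'
  rw [add_neg_cancel] at h
  obtain ⟨c, hc⟩ := h.scalar_of_zero hJ hprime hgen hII
  have hpc : p = c • q := by
    rw [← mul_one p, ← h2, ← mul_assoc, hc, smul_mul_assoc, one_mul]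
  refine ⟨c, fun h0 => hp.ne_zero hJ ?_, hpc⟩
  rw [hpc, h0, zero_smul]

-- Inverses of monomials are monomials, so their degrees form a subgroup containing the support; the
-- support itself need not be a subgroup.
omit [IsAddTorsionFree G] hgen hII in
theorem IsJordanTorus.exists_isMonomial (g : G) : ∃ p, IsMonomial 𝒥 g p := by
  have := hprime.1
  have hg : g ∈ AddSubgroup.closure {g : G | 𝒥 g ≠ ⊥} := hJ.closure_supp ▸ AddSubgroup.mem_top g
  induction hg using AddSubgroup.closure_induction with
  | mem a ha =>
    obtain ⟨x, hx, hx0⟩ := (Submodule.ne_bot_iff _).1 ha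
    exact ⟨x, IsMonomial.of_mem hx hx0⟩
  | zero => exact ⟨1, IsMonomial.one⟩
  | add a b _ _ h₁ h₂ =>
    obtain ⟨p, hp⟩ := h₁
    obtain ⟨q, hq⟩ := h₂
    exact ⟨p * q, hp.mul_mono hq⟩
  | neg a _ h =>
    obtain ⟨p, hp⟩ := h
    obtain ⟨q, hq, -⟩ := hp.exists_inv hJ
    exact ⟨q, hq⟩

/-- Monomials of distinct degrees are linearly independent. -/
theorem IsMonomial.sum_smul_eq_zero {w : G → A} (hw : ∀ g, IsMonomial 𝒥 g (w g)) (s : Finset G)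
    (c : G → F) (h : ∑ g ∈ s, c g • w g = 0) : ∀ g ∈ s, c g = 0 := by
  have := hprime.1
  intro g₀ hg₀
  -- Monomials may be skew, outside `J`. Multiplying by the inverse of `w g₀` turns the term at `g₀`
  -- into a multiple of `1`; `symmPart` then kills the skew terms and leaves a relation between
  -- homogeneous elements of `J`.
  obtain ⟨q, hq, h1, -⟩ := (hw g₀).exists_inv hJ
  have hmem : ∀ g, σ.symmPart (w g * q) ∈ 𝒥 (g + -g₀) := by
    intro g
    have hm := (hw g).mul_mono hq
    rcases hm.symm_or_skew hJ hprime hgen hII with h | h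
    · rw [σ.symmPart_of_symm h]
      exact hm.mem_of_symm hJ h
    · rw [σ.symmPart_of_skew h]
      exact Submodule.zero_mem _
  have hsum : ∑ g ∈ s, c g • σ.symmPart (w g * q) = 0 := by
    have := congrArg (fun z => σ.symmPart (z * q)) h
    simpa only [Finset.sum_mul, smul_mul_assoc, map_sum, map_smul, zero_mul, map_zero] using this
  have hind : iSupIndep fun g => 𝒥 (g + -g₀) := hJ.indep.comp (add_left_injective (-g₀))
  have h2 := (iSupIndep_iff_finsetSum_eq_zero_imp_eq_zero _).1 hind s
    (fun g => c g • σ.symmPart (w g * q)) (fun g _ => Submodule.smul_mem _ _ (hmem g)) hsum g₀ hg₀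
  rw [h1, σ.symmPart_of_symm σ.map_one] at h2
  exact (smul_eq_zero.1 h2).resolve_right one_ne_zero

open TwistedGroupAlgebra

/-- Without a central skew square root of a scalar, the Jordan torus has involution type. -/
theorem IsJordanTorus.isInvolutionType : IsInvolutionType σ.H 𝒥 := by
  classical
  have := hprime.1
  -- Degrees outside the support are represented by skew monomials.
  choose w hw using hJ.exists_isMonomial hprime
  have hw0 : ∀ g, w g ≠ 0 := fun g => (hw g).ne_zero hJ
  have hmul : ∀ a b, ∃ c : F, c ≠ 0 ∧ w a * w b = c • w (a + b) := fun a b =>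
    ((hw a).mul_mono (hw b)).exists_smul hJ hprime hgen hII (hw (a + b))
  choose l hl0 hl using hmul
  let lam : TwoCocycle G F := ⟨fun a b => Units.mk0 _ (hl0 a b), by
    intro a b c
    apply Units.ext
    simp only [Units.val_mul, Units.val_mk0]
    apply IsMonomial.smul_left_cancel_of_ne_zero (hw0 (a + b + c))
    have h1 : w a * w b * w c = (l (a + b) c * l a b) • w (a + b + c) := by
      rw [hl, smul_mul_assoc, hl, smul_smul, mul_comm]
    rw [← h1, mul_assoc, hl b c, mul_smul_comm, hl, smul_smul, add_assoc, mul_comm (l b c)]⟩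
  have hlam : ∀ a b, (lam a b : F) = l a b := fun a b => rfl
  have hsign : ∀ g, ∃ z : ZMod 2, σ (w g) = sign F z • w g := by
    intro g
    rcases (hw g).symm_or_skew hJ hprime hgen hII with h | h
    · exact ⟨0, by rw [h, sign_zero, one_smul]⟩
    · exact ⟨1, by rw [h, sign_one, neg_one_smul]⟩
  choose q hq using hsign
  -- This is `σ` applied to `w a * w b = l a b • w (a + b)`.
  have hcomp : ∀ a b, sign F (q a + q b - q (a + b)) * l b a = l a b := by
    intro a b
    have h1 : (sign F (q a + q b) * l b a) = l a b * sign F (q (a + b)) := by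
      apply IsMonomial.smul_left_cancel_of_ne_zero (hw0 (a + b))
      have h2 := congrArg σ.toLinearMap (hl a b)
      rw [σ.map_mul, map_smul, hq, hq, hq, smul_mul_smul_comm, hl b a, smul_smul, smul_smul,
        add_comm b a, mul_comm (sign F (q b)), sign_mul_sign] at h2
      exact h2
    have h3 : sign F (q a + q b - q (a + b)) * sign F (q (a + b)) = sign F (q a + q b) := by
      rw [sign_mul_sign, sub_add_cancel]
    have h4 := sign_mul_self (K := F) (q (a + b))
    linear_combination (sign F (q (a + b))) * h1 + sign F (q (a + b)) * l b a * h3 +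
      (l a b - sign F (q a + q b - q (a + b)) * l b a) * h4
  have hpolar : ∀ a b, q a + q b - q (a + b) = QuadraticMap.polar q a b := by
    intro a b
    rw [QuadraticMap.polar]
    generalize q a = x
    generalize q b = y
    generalize q (a + b) = z
    revert x y z
    decide
  have hcomm : ∀ a b, w a * w b = sign F (QuadraticMap.polar q a b) • (w b * w a) := by
    intro a b
    rw [hl, hl b a, smul_smul, add_comm b a, ← hpolar, hcomp]
  have hcommne : ∀ a b, w b * w a ≠ 0 := fun a b => ((hw b).mul_mono (hw a)).ne_zero hJ
  -- The polarization of `q` records the commutation sign of `w a` and `w b`. It is additive because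
  -- `w (a + a')` is proportional to `w a * w a'`, and alternating because `w a` commutes with
  -- itself.
  obtain ⟨Q, hQ⟩ := exists_quadraticMap_zmod_two q
    (by
      intro a a' b
      apply sign_injective F
      rw [← sign_mul_sign]
      apply IsMonomial.smul_left_cancel_of_ne_zero (hcommne (a + a') b)
      rw [← hcomm]
      apply smul_right_injective A (hl0 a a')
      simp only
      have e1 : l a a' • (w (a + a') * w b) = w a * (w a' * w b) := by
        rw [← smul_mul_assoc, ← hl, mul_assoc]
      rw [e1, hcomm a' b, mul_smul_comm, ← mul_assoc, hcomm a b, smul_mul_assoc, smul_smul,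
        mul_assoc, hl a a', mul_smul_comm, smul_comm, mul_comm (sign F _)])
    (by
      intro a
      apply sign_injective F
      apply IsMonomial.smul_left_cancel_of_ne_zero (hcommne a a)
      rw [← hcomm, sign_zero, one_smul])
  have hQc : Compatible lam Q := by
    intro a b
    rw [hQ, hQ, hQ, Units.val_mul, Units.val_inv_eq_inv_val, hlam, hlam,
      eq_mul_inv_iff_mul_eq₀ (hl0 b a), hcomp]
  refine ⟨lam, Q, hQc, ?_⟩
  obtain ⟨Ψ, hΨ⟩ : ∃ Ψ, Ψ = eval lam (Algebra.ofId F A) w := ⟨_, rfl⟩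
  have hΨs : ∀ g c, Ψ (single lam g c) = c • w g := fun g c => by
    rw [hΨ, eval_single, Algebra.smul_def]
    rfl
  have hΨmul : ∀ f g, Ψ (f * g) = Ψ f * Ψ g := by
    rw [hΨ]
    refine eval_mul lam _ w (fun c g => Algebra.commutes c _) fun a b => ?_
    rw [hl, Algebra.smul_def]
    rfl
  have hinj : Function.Injective Ψ := by
    rw [hΨ]
    refine eval_injective lam _ w fun s c h => ?_
    apply IsMonomial.sum_smul_eq_zero hJ hprime hgen hII hw s c
    rw [← h]
    exact Finset.sum_congr rfl fun g _ => Algebra.smul_def _ _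
  have hΨσ : ∀ f, Ψ (theta lam Q hQc f) = σ (Ψ f) := by
    intro f
    induction f using induction with
    | zero => rw [map_zero, map_zero, map_zero]
    | add f₁ f₂ h₁ h₂ => rw [map_add, map_add, map_add, map_add, h₁, h₂]
    | single g c => rw [theta_single, hΨs, hΨs, map_smul, hq, hQ, smul_smul]
  have hmem : ∀ g, ∀ a ∈ 𝒥 g, ∃ c : F, a = c • w g := by
    intro g a ha
    by_cases ha0 : a = 0
    · exact ⟨0, by rw [ha0, zero_smul]⟩
    · obtain ⟨c, -, hc⟩ := (IsMonomial.of_mem ha ha0).exists_smul hJ hprime hgen hII (hw g)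
      exact ⟨c, hc⟩
  refine GradedJordanIso.of_linearMap hJ.iSup_eq
    (iSup_component_inf_H lam _ (theta_component lam Q hQc))
    (fun _ hx _ hy => AlgInvolution.jordanMul_mem _ hx hy)
    (Ψ ∘ₗ (theta lam Q hQc).H.subtype) ?_ ?_ ?_
  · exact Function.Injective.comp (g := Ψ) hinj (Submodule.subtype_injective _)
  · intro x y z h
    change Ψ z = jordanMul F (Ψ x) (Ψ y)
    rw [h, jordanMul, map_smul, map_add, hΨmul, hΨmul, jordanMul]
  · intro g a
    constructor
    · intro ha
      obtain ⟨c, rfl⟩ := hmem g a ha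
      have h1 : theta lam Q hQc (single lam g c) = single lam g c :=
        hinj (by rw [hΨσ, hΨs, hJ.symm ha])
      exact ⟨⟨_, h1⟩, ⟨⟨c, rfl⟩, h1⟩, hΨs g c⟩
    · rintro ⟨⟨_, h⟩, ⟨⟨c, rfl⟩, -⟩, rfl⟩
      change Ψ (single lam g c) ∈ 𝒥 g
      have h1 : σ (Ψ (single lam g c)) = Ψ (single lam g c) := by
        rw [← hΨσ]
        exact congrArg Ψ h
      rw [hΨs] at h1 ⊢
      by_cases hc : c = 0
      · rw [hc, zero_smul]
        exact Submodule.zero_mem _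
      · rw [map_smul] at h1
        exact Submodule.smul_mem _ _ ((hw g).mem_of_symm hJ (smul_right_injective A hc h1))

end InvolutionType

theorem mainTheorem6 {F : Type u} {P : Type v} {G : Type w} {ι : Type*}
    [Field F] [CharZero F] [Ring P] [Algebra F P] [AddCommGroup G] [IsAddTorsionFree G]
    (star : AlgInvolution F P) (hprime : star.IsPrime)
    (hgen : Algebra.adjoin F (star.H : Set P) = ⊤)
    (𝒥 : G → Submodule F P) (hJ : IsJordanTorus star.H 𝒥)
    (Gs : ι → AddSubgroup G) (hfree : ∀ i, Module.Free ℤ (Gs i))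
    (hcover : ⋃ i, (Gs i : Set G) = Set.univ)
    (hstar : ∀ i, ∀ x ∈ Algebra.adjoin F (gradedPart 𝒥 (Gs i) : Set P),
      star x ∈ Algebra.adjoin F (gradedPart 𝒥 (Gs i) : Set P))
    (hsymm : ∀ i, (gradedPart 𝒥 (Gs i) : Set P) =
      {x | x ∈ Algebra.adjoin F (gradedPart 𝒥 (Gs i) : Set P) ∧ star x = x}) :
    (IsInvolutionType star.H 𝒥 ∨ IsPlusType star.H 𝒥 ∨ IsExtensionType star.H 𝒥) ∧
    (IsInvolutionType star.H 𝒥 →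
      IsDirectUnionOfTori star.H 𝒥 fun _ V 𝒦 => IsInvolutionType V 𝒦) ∧
    (IsPlusType star.H 𝒥 →
      IsDirectUnionOfTori star.H 𝒥 fun _ V 𝒦 => IsPlusType V 𝒦) ∧
    (IsExtensionType star.H 𝒥 →
      IsDirectUnionOfTori star.H 𝒥 fun _ V 𝒦 => IsExtensionType V 𝒦) := by
  have := hprime.1
  have hmul : ∀ x ∈ star.H, ∀ y ∈ star.H, jordanMul F x y ∈ star.H :=
    fun x hx y hy => star.jordanMul_mem hx hy
  refine ⟨?_, fun h => hJ.isDirectUnionOfTori _ fun H => h.restrict hJ.le hmul H,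
    fun h => hJ.isDirectUnionOfTori _ fun H => h.restrict hJ.le hmul H,
    fun h => hJ.isDirectUnionOfTori _ fun H => h.restrict hJ.le hmul H⟩
  by_cases hII : star.HasCentralSkewRoot
  · obtain ⟨ε, d, hs, hc, hd, hε⟩ := hII
    by_cases hr : ∃ r, r * r = d
    · obtain ⟨r, hr⟩ := hr
      exact Or.inr (Or.inl (hJ.isPlusType hs hc hd hε hr))
    · push Not at hr
      exact Or.inr (Or.inr (hJ.isExtensionType hs hc hd hε hr))
  · exact Or.inl (hJ.isInvolutionType hprime hgen hII)
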